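/- Let $d\ge 2$ and let $F$ be a probability measure on $[0,\infty[$. The edges $e$ of the nearest-neighbour graph on $\mathbb{Z}^d$ carry independent capacities $t(e)$ with common law $F$; write $\mathbb{P}$ for the product measure and put $$\mu=\sup\{\lambda\ge 0 : F([0,\lambda[)<1\}\in[0,+\infty].$$ For $n,m\in\mathbb{N}$ let $B=\,]0,n]^{d-1}\times\,]0,m]$, with bottom $F_0=\,]0,n]^{d-1}\times\{0\}$ and top $F_m=\,]0,n]^{d-1}\times\{m\}$; the edges of the box are the edges joining two vertices of $B\cup F_0$ that are not both in $F_0$. A stream assigns to each edge $e$ a direction and an amount $g(e)\ge 0$, with $g(e)\le t(e)$ for every edge of the box, such that at each vertex of $B\smallsetminus F_m$ the amounts coming in and going out along edges of the box are equal. Its flow is the net amount going along edges of the box from vertices outside $F_m$ to vertices of $F_m$, and the maximal flow $\phi_{n^{d-1},m}$ is the supremum of the flows of all streams. For $k>0$ let $\phi^{k}_{n^{d-1},m}$ be the maximal flow for the capacities $t^k(e)=\lfloor k\,t(e)\rfloor/k$ in place of $t(e)$. Call a pair $(h,(\chi_n)_{n\in\mathbb{N}})$ admissible if $h:\mathbb{N}\to\mathbb{N}$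 satisfies $h(n)\to+\infty$, $(\chi_n)$ is a non-decreasing sequence of integers with $\chi_n\to+\infty$, and $$\lim_{n\to\infty}\frac{\chi_n\ln n}{h(n)}=0 .$$ Then for every admissible pair $(h,(\chi_n))$ and every $\lambda\in[0,+\infty[$ with $\lambda\ne\mu$, the limit $$\widetilde\psi(\lambda)=\lim_{n\to\infty}-\frac{1}{n^{d-1}h(n)}\ln\mathbb{P}\left[\phi^{2^{\chi_n}}_{n^{d-1},h(n)}\ge\lambda n^{d-1}\right]$$ exists in $[0,+\infty]$ (with $\ln 0=-\infty$), and it does not depend on the admissible pair $(h,(\chi_n))$. -/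

import Mathlib

open MeasureTheory Filter Topology
open scoped NNReal ENNReal

namespace FPP

/-! The ambient dimension is `d = D + 1`; the last coordinate is the vertical one. -/

/-- Vertices of the lattice `ℤ ^ (D + 1)`. -/
abbrev Vertex (D : ℕ) : Type := Fin (D + 1) → ℤ

/-- Unoriented nearest-neighbour edges of `ℤ ^ (D + 1)`: the pair `(x, i)` stands for the edge
`⟨x, x + eᵢ⟩`, so that every pair of points at `L¹` distance one is represented exactly once. -/
abbrev Edge (D : ℕ) : Type := Vertex D × Fin (D + 1)

/-- The endpoint `x` of `⟨x, x + eᵢ⟩`. -/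
def lowerEnd {D : ℕ} (e : Edge D) : Vertex D := e.1

/-- The endpoint `x + eᵢ` of `⟨x, x + eᵢ⟩`. -/
def upperEnd {D : ℕ} (e : Edge D) : Vertex D := e.1 + Pi.single e.2 1

/-- The lattice points of `∏ᵢ ]0, kᵢ] × s`. -/
noncomputable def slab {D : ℕ} (k : Fin D → ℕ) (s : Finset ℤ) : Finset (Vertex D) :=
  Fintype.piFinset
    (Fin.snoc (α := fun _ => Finset ℤ) (fun i => Finset.Ioc (0 : ℤ) (k i : ℤ)) s)

/-- The lattice points of the box `B = ∏ᵢ ]0, kᵢ] × ]0, m]`. -/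
noncomputable def box {D : ℕ} (k : Fin D → ℕ) (m : ℕ) : Finset (Vertex D) :=
  slab k (Finset.Ioc (0 : ℤ) (m : ℤ))

/-- The bottom `F₀ = ∏ᵢ ]0, kᵢ] × {0}` (disjoint from `B`). -/
noncomputable def bottomFace {D : ℕ} (k : Fin D → ℕ) : Finset (Vertex D) := slab k {0}

/-- The top `F_m = ∏ᵢ ]0, kᵢ] × {m}`. -/
noncomputable def topFace {D : ℕ} (k : Fin D → ℕ) (m : ℕ) : Finset (Vertex D) := slab k {(m : ℤ)}

/-- The edges of the box: the edges joining two points of `B ∪ F₀` whose open segment lies in `B`,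
that is, which are not contained in `F₀`. -/
noncomputable def boxEdges {D : ℕ} (k : Fin D → ℕ) (m : ℕ) : Finset (Edge D) :=
  ((box k m ∪ bottomFace k) ×ˢ Finset.univ).filter
    (fun e => upperEnd e ∈ box k m ∪ bottomFace k ∧
      ¬ (lowerEnd e ∈ bottomFace k ∧ upperEnd e ∈ bottomFace k))

/-- `(g, o)` is a stream in the box for the capacities `t`: `g e` is the amount of fluid through
`e`, and `o e = (u, v)` means that it goes from `u` to `v`. -/
structure IsStream {D : ℕ} (t : Edge D → ℝ≥0) (k : Fin D → ℕ) (m : ℕ)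
    (g : Edge D → ℝ) (o : Edge D → Vertex D × Vertex D) : Prop where
  nonneg : ∀ e, 0 ≤ g e
  orientation : ∀ e, o e = (lowerEnd e, upperEnd e) ∨ o e = (upperEnd e, lowerEnd e)
  le_capacity : ∀ e ∈ boxEdges k m, g e ≤ t e
  balance : ∀ v ∈ box k m \ topFace k m,
    ∑ e ∈ (boxEdges k m).filter (fun e => (o e).1 = v), g e =
      ∑ e ∈ (boxEdges k m).filter (fun e => (o e).2 = v), g e

/-- The flow of `(g, o)`: the net amount of fluid entering the top of the box from the rest of
the box. -/
noncomputable def flow {D : ℕ} (k : Fin D → ℕ) (m : ℕ)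
    (g : Edge D → ℝ) (o : Edge D → Vertex D × Vertex D) : ℝ :=
  ∑ e ∈ (boxEdges k m).filter (fun e => (o e).1 ∉ topFace k m ∧ (o e).2 ∈ topFace k m), g e -
    ∑ e ∈ (boxEdges k m).filter (fun e => (o e).1 ∈ topFace k m ∧ (o e).2 ∉ topFace k m), g e

/-- The maximal flow through the box from its bottom to its top, for the capacities `t`. -/
noncomputable def maxFlow {D : ℕ} (t : Edge D → ℝ≥0) (k : Fin D → ℕ) (m : ℕ) : ℝ :=
  sSup {a : ℝ | ∃ g o, IsStream t k m g o ∧ a = flow k m g o}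

/-- The discretized capacities `⌊κ t(e)⌋ / κ`. -/
noncomputable def discretize {D : ℕ} (κ : ℝ≥0) (t : Edge D → ℝ≥0) : Edge D → ℝ≥0 :=
  fun e => (⌊κ * t e⌋₊ : ℝ≥0) / κ

/-- `μ = sup {λ ≥ 0 | F([0, λ[) < 1}`, in `[0, ∞]`. -/
noncomputable def supSupport (F : Measure ℝ≥0) : ℝ≥0∞ :=
  ⨆ (l : ℝ≥0) (_ : F (Set.Iio l) < 1), (l : ℝ≥0∞)

/-- The probability that the maximal flow through `]0, n] ^ D × ]0, m]`, for capacities discretized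
at scale `1 / κ`, is at least `l * n ^ D`; the capacities are i.i.d. with law `F`. -/
noncomputable def upperProb (D : ℕ) (F : Measure ℝ≥0) [IsProbabilityMeasure F]
    (κ : ℝ≥0) (n m : ℕ) (l : ℝ≥0) : ℝ≥0∞ :=
  Measure.infinitePi (fun _ : Edge D => F)
    {t | (l : ℝ) * (n : ℝ) ^ D ≤ maxFlow (discretize κ t) (fun _ => n) m}

/-- The rescaled logarithm `-(1 / (n ^ D * m)) * ln P[...]`, where `ln 0 = -∞`. -/
noncomputable def rate (D : ℕ) (F : Measure ℝ≥0) [IsProbabilityMeasure F]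
    (κ : ℝ≥0) (n m : ℕ) (l : ℝ≥0) : EReal :=
  -(((1 / ((n : ℝ) ^ D * (m : ℝ)) : ℝ) : EReal) * ENNReal.log (upperProb D F κ n m l))

/-- The standing conditions on a pair `(h, χ)`. -/
structure Admissible (h : ℕ → ℕ) (χ : ℕ → ℤ) : Prop where
  height : Tendsto h atTop atTop
  mono : Monotone χ
  exponent : Tendsto χ atTop atTop
  ratio : Tendsto (fun n : ℕ => (χ n : ℝ) * Real.log (n : ℝ) / (h n : ℝ)) atTop (𝓝 0)

end FPP

/-!
The rate of a box is compared with the rates of all much larger boxes, in the spirit of Fekete's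
lemma. Let `N × M` be a small box (side `N`, height `M`) and `n × H` a much larger one, possibly
with a finer discretization, which only enlarges the discretized capacities.

*From the small box to boundary conditions.* For discretized capacities the max-flow problem is
integral (`exists_integral_flow`). Hence a flow of at least `l * N ^ D` may be assumed to enter
and to leave the box, at each point of its bottom and of its top, with amounts which are multiples
of `1 / κ` and are bounded by a multiple of the required flow, whatever the law `F`
(`exists_conduit_of_le_maxFlow`). There are `exp (O(N ^ D * (χ_N + log N)))` such boundary
conditions, so that one of them, `(a, b)`, is realized with a probability that differs from that
of the large flow by this factor at most (`exists_upperProb_le`). The condition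
`χ_N * log N / h N → 0` makes this factor negligible at the scale `N ^ D * h N` (`tendsto_log_card_div`).

*From boundary conditions to the large box.* The large box is tiled by translates of the small
one. By reflection, the boundary conditions `(a, b)` and `(b, a)` have the same probability
(`measure_conduitEvent_symm`). Requiring them alternately in the successive layers, the flows fit
together; the fringe which is not covered by the tiling is crossed by vertical lines of capacity
at least `l`, which has a positive probability per edge when `l < μ` (`exists_conduit_glue`). By
independence of the cells the probability of the large flow is at least a product
(`pow_mul_pow_le_upperProb`), in which the fringe does not count in the limit.

Together, for `l < μ` the upper limit of the rates of any admissible pair is at most the lower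
limit of the rates of any other one (`limsup_rate_le_liminf_rate`), which gives at once the
existence of the limit and its independence of the pair. For `l > μ` the flow is almost surely too
small and all the rates are eventually infinite (`tendsto_rate_top`).
-/

namespace FPP

/-! ### Integral flows in finite networks -/

section Network

variable {V E R : Type*} [DecidableEq V] [CommRing R]

/-- The net inflow at `w` of the signed flow `f`, along the edges of `A`; a positive `f e` goes from
`s e` to `t e`. -/
def netDiv (A : Finset E) (s t : E → V) (f : E → R) (w : V) : R :=
  ∑ e ∈ A, f e * ((if t e = w then 1 else 0) - (if s e = w then 1 else 0))

theorem netDiv_add (A : Finset E) (s t : E → V) (f g : E → R) (w : V) :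
    netDiv A s t (fun e => f e + g e) w = netDiv A s t f w + netDiv A s t g w := by
  simp only [netDiv, add_mul, Finset.sum_add_distrib]

theorem sum_netDiv (A : Finset E) (s t : E → V) (f : E → R) (W : Finset V) :
    ∑ w ∈ W, netDiv A s t f w =
      ∑ e ∈ A, f e * ((if t e ∈ W then 1 else 0) - (if s e ∈ W then 1 else 0)) := by
  simp only [netDiv]
  rw [Finset.sum_comm]
  refine Finset.sum_congr rfl fun e _ => ?_
  rw [← Finset.mul_sum, Finset.sum_sub_distrib, Finset.sum_ite_eq, Finset.sum_ite_eq]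

/-- The value of a flow is the net amount that leaves any set of vertices which contains the
sources and no sink. -/
theorem sum_netDiv_sink_eq_cut {A : Finset E} {s t : E → V} {W B T S : Finset V}
    (hs : ∀ e ∈ A, s e ∈ W) (ht : ∀ e ∈ A, t e ∈ W) (hTW : T ⊆ W) (hBS : B ⊆ S)
    (hST : Disjoint S T) (f : E → R)
    (hf : ∀ w ∈ W, w ∉ B → w ∉ T → netDiv A s t f w = 0) :
    ∑ w ∈ T, netDiv A s t f w =
      ∑ e ∈ A, f e * ((if s e ∈ S then 1 else 0) - (if t e ∈ S then 1 else 0)) := by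
  have h1 : ∑ w ∈ T, netDiv A s t f w = ∑ w ∈ W \ S, netDiv A s t f w := by
    refine Finset.sum_subset (fun w hw => Finset.mem_sdiff.2
      ⟨hTW hw, fun h => Finset.disjoint_left.1 hST h hw⟩) fun w hw hwT => ?_
    rw [Finset.mem_sdiff] at hw
    exact hf w hw.1 (fun h => hw.2 (hBS h)) hwT
  rw [h1, sum_netDiv]
  refine Finset.sum_congr rfl fun e he => ?_
  congr 1
  by_cases h1 : s e ∈ S <;> by_cases h2 : t e ∈ S <;> simp [h1, h2, hs e he, ht e he]

/-- One augmentation step: an integral flow that respects the capacities `c` can be improved by one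
unit, or else it saturates a cut `S`. Instead of augmenting paths, the proof considers the sets `S`
of vertices to which one unit can be sent from the sources inside `S`, and takes a maximal one. -/
theorem exists_augment_or_cut {A : Finset E} {s t : E → V} {W B T : Finset V}
    (hs : ∀ e ∈ A, s e ∈ W) (ht : ∀ e ∈ A, t e ∈ W) (hBW : B ⊆ W)
    (hBT : Disjoint B T) (c : E → ℤ) (f : E → ℤ) (hc : ∀ e ∈ A, |f e| ≤ c e)
    (hf : ∀ w ∈ W, w ∉ B → w ∉ T → netDiv A s t f w = 0) :
    (∃ f' : E → ℤ, (∀ e ∈ A, |f' e| ≤ c e) ∧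
      (∀ w ∈ W, w ∉ B → w ∉ T → netDiv A s t f' w = 0) ∧
      ∑ w ∈ T, netDiv A s t f' w = ∑ w ∈ T, netDiv A s t f w + 1) ∨
    ∃ S : Finset V, B ⊆ S ∧ Disjoint S T ∧
      (∀ e ∈ A, s e ∈ S → t e ∉ S → f e = c e) ∧
      (∀ e ∈ A, s e ∉ S → t e ∈ S → f e = -c e) := by
  classical
  let P : Finset V → Prop := fun S => B ⊆ S ∧ ∀ v ∈ S, ∃ δ : E → ℤ,
    (∀ e ∈ A, |f e + δ e| ≤ c e) ∧ (∀ e ∈ A, δ e ≠ 0 → s e ∈ S ∧ t e ∈ S) ∧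
    ∀ w, w ∉ B → netDiv A s t δ w = if v = w then 1 else 0
  have hPB : P B := by
    refine ⟨subset_rfl, fun v hv => ⟨fun _ => 0, by simpa using hc, by simp, fun w hw => ?_⟩⟩
    rw [if_neg (by rintro rfl; exact hw hv)]
    simp [netDiv]
  obtain ⟨S, hS, hmax⟩ := (W.powerset.filter P).exists_maximal
    ⟨B, Finset.mem_filter.2 ⟨Finset.mem_powerset.2 hBW, hPB⟩⟩
  rw [Finset.mem_filter, Finset.mem_powerset] at hS
  obtain ⟨hSW, hBS, hPS⟩ := hS
  by_cases hST : Disjoint S T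
  · right
    -- A residual edge `e` from `u ∈ S` to `v ∉ S` would allow to enlarge `S` by `v`.
    have key : ∀ e ∈ A, ∀ u v : V, ∀ σ : ℤ, u ∈ S → v ∉ S → v ∈ W →
        ((s e = u ∧ t e = v ∧ σ = 1) ∨ (s e = v ∧ t e = u ∧ σ = -1)) →
        ¬ |f e + σ| ≤ c e := by
      intro e he u v σ hu hv hvW hcase hcap
      have hPi : P (insert v S) := by
        refine ⟨hBS.trans (Finset.subset_insert _ _), fun x hx => ?_⟩
        rcases Finset.mem_insert.1 hx with rfl | hx
        · obtain ⟨δ, h1, h2, h3⟩ := hPS u hu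
          have hδe : δ e = 0 := by
            by_contra h
            rcases hcase with ⟨_, h', _⟩ | ⟨h', _, _⟩
            · exact hv (h' ▸ (h2 e he h).2)
            · exact hv (h' ▸ (h2 e he h).1)
          refine ⟨fun e' => δ e' + if e' = e then σ else 0, fun e' he' => ?_, fun e' he' h => ?_,
            fun w hw => ?_⟩
          · by_cases hee : e' = e
            · subst hee; simpa [hδe] using hcap
            · simpa [hee] using h1 e' he'
          · by_cases hee : e' = e
            · subst hee
              rcases hcase with ⟨h', h'', _⟩ | ⟨h', h'', _⟩ <;> simp [h', h'', hu]
            · have := h2 e' he' (by simpa [hee] using h)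
              exact ⟨Finset.mem_insert_of_mem this.1, Finset.mem_insert_of_mem this.2⟩
          · rw [netDiv_add, h3 w hw]
            have : netDiv A s t (fun e' => if e' = e then σ else 0) w =
                σ * ((if t e = w then 1 else 0) - (if s e = w then 1 else 0)) := by
              simp only [netDiv, ite_mul, zero_mul]
              rw [Finset.sum_ite_eq' A e]; simp [he]
            rw [this]
            rcases hcase with ⟨h', h'', rfl⟩ | ⟨h', h'', rfl⟩ <;> rw [h', h''] <;> ring
        · obtain ⟨δ, h1, h2, h3⟩ := hPS x hx
          exact ⟨δ, h1, fun e he h => ⟨Finset.mem_insert_of_mem (h2 e he h).1,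
            Finset.mem_insert_of_mem (h2 e he h).2⟩, h3⟩
      have := hmax (Finset.mem_filter.2 ⟨Finset.mem_powerset.2
        (Finset.insert_subset hvW hSW), hPi⟩) (Finset.subset_insert v S)
      exact hv (this (Finset.mem_insert_self v S))
    refine ⟨S, hBS, hST, fun e he h1 h2 => ?_, fun e he h1 h2 => ?_⟩
    · have h3 := key e he _ _ 1 h1 h2 (ht e he) (Or.inl ⟨rfl, rfl, rfl⟩)
      have h4 := hc e he
      rw [abs_le] at h3 h4
      omega
    · have h3 := key e he _ _ (-1) h2 h1 (hs e he) (Or.inr ⟨rfl, rfl, rfl⟩)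
      have h4 := hc e he
      rw [abs_le] at h3 h4
      omega
  · left
    obtain ⟨v, hvS, hvT⟩ := Finset.not_disjoint_iff.1 hST
    obtain ⟨δ, h1, _, h3⟩ := hPS v hvS
    refine ⟨fun e => f e + δ e, h1, fun w hw hwB hwT => ?_, ?_⟩
    · rw [netDiv_add, hf w hw hwB hwT, h3 w hwB, if_neg (by rintro rfl; exact hwT hvT), add_zero]
    · simp only [netDiv_add, Finset.sum_add_distrib]
      congr 1
      rw [Finset.sum_congr rfl fun w hw => h3 w (Finset.disjoint_right.1 hBT hw)]
      simp [hvT]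

/-- Max-flow integrality: if a real flow for the integral capacities `c` has value more than
`N - 1`, then there is an integral flow of value at least `N`, none of whose amounts exceeds `N`. -/
theorem exists_integral_flow {A : Finset E} {s t : E → V} {W B T : Finset V}
    (hs : ∀ e ∈ A, s e ∈ W) (ht : ∀ e ∈ A, t e ∈ W) (hBW : B ⊆ W) (hTW : T ⊆ W)
    (hBT : Disjoint B T) (c : E → ℕ) (N : ℕ) (g : E → ℝ) (hg : ∀ e ∈ A, |g e| ≤ c e)
    (hgdiv : ∀ w ∈ W, w ∉ B → w ∉ T → netDiv A s t g w = 0)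
    (hval : (N : ℝ) - 1 < ∑ w ∈ T, netDiv A s t g w) :
    ∃ f : E → ℤ, (∀ e ∈ A, |f e| ≤ min (c e : ℤ) N) ∧
      (∀ w ∈ W, w ∉ B → w ∉ T → netDiv A s t f w = 0) ∧
      (N : ℤ) ≤ ∑ w ∈ T, netDiv A s t f w := by
  suffices H : ∀ k : ℕ, k ≤ N → ∃ f : E → ℤ, (∀ e ∈ A, |f e| ≤ min (c e : ℤ) N) ∧
      (∀ w ∈ W, w ∉ B → w ∉ T → netDiv A s t f w = 0) ∧
      (k : ℤ) ≤ ∑ w ∈ T, netDiv A s t f w from H N le_rfl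
  intro k
  induction k with
  | zero =>
    intro _
    exact ⟨fun _ => 0, by simp, by simp [netDiv], by simp [netDiv]⟩
  | succ k ih =>
    intro hk
    obtain ⟨f, hc, hf, hkf⟩ := ih (by omega)
    rcases exists_augment_or_cut hs ht hBW hBT _ f hc hf with
      ⟨f', h1, h2, h3⟩ | ⟨S, hBS, hST, h1, h2⟩
    · exact ⟨f', h1, h2, by push_cast; omega⟩
    · refine ⟨f, hc, hf, ?_⟩
      by_contra hlt
      have hltN : ∑ w ∈ T, netDiv A s t f w < N := by push_cast at hlt; omega
      rw [sum_netDiv_sink_eq_cut hs ht hTW hBS hST f hf] at hltN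
      rw [sum_netDiv_sink_eq_cut hs ht hTW hBS hST g hgdiv] at hval
      -- the terms of the cut sum are nonnegative and add up to less than `N`, so that each of
      -- the capacities of the cut is less than `N` and equal to `c e`
      have hterm : ∀ e ∈ A,
          0 ≤ f e * ((if s e ∈ S then 1 else 0) - (if t e ∈ S then 1 else 0)) := by
        intro e he
        have h3 : (0 : ℤ) ≤ min (c e : ℤ) N := by positivity
        by_cases hse : s e ∈ S <;> by_cases hte : t e ∈ S
        · simp [hse, hte]
        · simp [hse, hte, h1 e he hse hte]
        · simp [hse, hte, h2 e he hse hte]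
        · simp [hse, hte]
      have hle : ∑ e ∈ A, g e * ((if s e ∈ S then 1 else 0) - (if t e ∈ S then 1 else 0)) ≤
          ((∑ e ∈ A, f e * ((if s e ∈ S then 1 else 0) - (if t e ∈ S then 1 else 0)) : ℤ) : ℝ) := by
        rw [Int.cast_sum]
        refine Finset.sum_le_sum fun e he => ?_
        have h3 := (Finset.single_le_sum hterm he).trans_lt hltN
        have h4 := abs_le.1 (hg e he)
        by_cases hse : s e ∈ S <;> by_cases hte : t e ∈ S
        · simp [hse, hte]
        · have h5 := h1 e he hse hte
          simp only [hse, hte, if_true, if_false, sub_zero, mul_one] at h3 ⊢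
          have h6 : f e = c e := by omega
          rw [h6]; simpa using h4.2
        · have h5 := h2 e he hse hte
          simp only [hse, hte, if_true, if_false, zero_sub, mul_neg, mul_one] at h3 ⊢
          have h6 : -f e = c e := by omega
          rw [h6]; simpa using neg_le.1 h4.1
        · simp [hse, hte]
      have h7 := hval.trans_le hle
      have h8 : (N : ℤ) - 1 <
          ∑ e ∈ A, f e * ((if s e ∈ S then 1 else 0) - (if t e ∈ S then 1 else 0)) := by
        exact_mod_cast h7
      omega

end Network

/-! ### Boxes of the lattice -/

variable {D : ℕ}

/-- The height of a vertex: its last coordinate. -/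
abbrev height (v : Vertex D) : ℤ := v (Fin.last D)

/-- The horizontal projection of a vertex. -/
abbrev base (v : Vertex D) : Fin D → ℤ := fun i => v i.castSucc

/-- The horizontal section `∏ᵢ ]0, kᵢ]` of a box. -/
noncomputable def crossSection (k : Fin D → ℕ) : Finset (Fin D → ℤ) :=
  Fintype.piFinset fun i => Finset.Ioc (0 : ℤ) (k i : ℤ)

theorem mem_slab {k : Fin D → ℕ} {s : Finset ℤ} {v : Vertex D} :
    v ∈ slab k s ↔ base v ∈ crossSection k ∧ height v ∈ s := by
  simp only [slab, crossSection, Fintype.mem_piFinset]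
  rw [Fin.forall_fin_succ']
  simp [Fin.snoc_castSucc, Fin.snoc_last]

/-- The sum of the heights of the endpoints of an edge. In the box of height `m` it lies between `0`
and `2 * m`, with equality exactly for the edges inside the bottom and inside the top. -/
def heightSum (e : Edge D) : ℤ := height (lowerEnd e) + height (upperEnd e)

theorem height_upperEnd (e : Edge D) :
    height (upperEnd e) = height (lowerEnd e) + if e.2 = Fin.last D then 1 else 0 := by
  simp only [height, upperEnd, lowerEnd, Pi.add_apply, Pi.single_apply]
  simp only [eq_comm]

theorem heightSum_eq (e : Edge D) :
    heightSum e = 2 * height (lowerEnd e) + if e.2 = Fin.last D then 1 else 0 := by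
  rw [heightSum, height_upperEnd]; ring

theorem lowerEnd_ne_upperEnd (e : Edge D) : lowerEnd e ≠ upperEnd e := by
  intro h
  have := congrFun h e.2
  simp [lowerEnd, upperEnd] at this

theorem mem_boxEdges {k : Fin D → ℕ} {m : ℕ} {e : Edge D} :
    e ∈ boxEdges k m ↔ lowerEnd e ∈ slab k (Finset.Icc 0 (m : ℤ)) ∧
      upperEnd e ∈ slab k (Finset.Icc 0 (m : ℤ)) ∧ 0 < heightSum e := by
  have h : ∀ v : Vertex D, v ∈ box k m ∪ bottomFace k ↔ v ∈ slab k (Finset.Icc 0 (m : ℤ)) := by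
    intro v
    simp only [Finset.mem_union, box, bottomFace, mem_slab, Finset.mem_Ioc, Finset.mem_singleton,
      Finset.mem_Icc]
    constructor
    · rintro (⟨h1, h2⟩ | ⟨h1, h2⟩) <;> exact ⟨h1, by omega⟩
    · rintro ⟨h1, h2⟩
      by_cases h3 : height v = 0
      · exact Or.inr ⟨h1, h3⟩
      · exact Or.inl ⟨h1, by omega⟩
  simp only [boxEdges, Finset.mem_filter, Finset.mem_product, Finset.mem_univ, and_true, h]
  rw [show e.1 = lowerEnd e from rfl]
  simp only [bottomFace, mem_slab, Finset.mem_singleton, Finset.mem_Icc, heightSum]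
  constructor
  · rintro ⟨h1, h2, h3⟩
    refine ⟨h1, h2, ?_⟩
    by_contra h4
    exact h3 ⟨⟨h1.1, by omega⟩, ⟨h2.1, by omega⟩⟩
  · rintro ⟨h1, h2, h3⟩
    exact ⟨h1, h2, fun h4 => by omega⟩

/-- The edges of the box which do not lie in its top face. -/
noncomputable def innerEdges (k : Fin D → ℕ) (m : ℕ) : Finset (Edge D) :=
  (boxEdges k m).filter fun e => heightSum e < 2 * m

theorem mem_innerEdges {k : Fin D → ℕ} {m : ℕ} {e : Edge D} :
    e ∈ innerEdges k m ↔ base (lowerEnd e) ∈ crossSection k ∧ base (upperEnd e) ∈ crossSection k ∧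
      0 < heightSum e ∧ heightSum e < 2 * m := by
  simp only [innerEdges, Finset.mem_filter, mem_boxEdges, mem_slab, Finset.mem_Icc]
  have h := height_upperEnd e
  have h' := heightSum_eq e
  constructor
  · rintro ⟨⟨⟨h1, -⟩, ⟨h2, -⟩, h3⟩, h4⟩
    exact ⟨h1, h2, h3, h4⟩
  · rintro ⟨h1, h2, h3, h4⟩
    split_ifs at h h' <;> exact ⟨⟨⟨h1, by omega⟩, ⟨h2, by omega⟩, h3⟩, h4⟩

/-! ### Signed flows on the lattice -/

/-- The net inflow at `v` of the signed flow `f` on the edges of the whole lattice; a positive `f e`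
goes from `lowerEnd e` to `upperEnd e`. -/
def netInflow (f : Edge D → ℝ) (v : Vertex D) : ℝ :=
  ∑ i, (f (v - Pi.single i 1, i) - f (v, i))

theorem netInflow_sum {ι : Type*} (s : Finset ι) (f : ι → Edge D → ℝ) (v : Vertex D) :
    netInflow (fun e => ∑ j ∈ s, f j e) v = ∑ j ∈ s, netInflow (f j) v := by
  simp only [netInflow]
  rw [Finset.sum_comm]
  simp only [Finset.sum_sub_distrib]

theorem netInflow_add (f g : Edge D → ℝ) (v : Vertex D) :
    netInflow (fun e => f e + g e) v = netInflow f v + netInflow g v := by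
  simp only [netInflow, ← Finset.sum_add_distrib]
  exact Finset.sum_congr rfl fun i _ => by ring

/-- The lattice form of the net inflow agrees with that of a finite network. -/
theorem netDiv_eq_netInflow {A : Finset (Edge D)} {f : Edge D → ℝ} {v : Vertex D}
    (h : ∀ e, f e ≠ 0 → lowerEnd e = v ∨ upperEnd e = v → e ∈ A) :
    netDiv A lowerEnd upperEnd f v = netInflow f v := by
  classical
  have h1 : ∑ e ∈ A, f e * (if upperEnd e = v then 1 else 0) =
      ∑ i, f (v - Pi.single i 1, i) := by
    have h2 : ∑ i, f (v - Pi.single i 1, i) =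
        ∑ e ∈ Finset.univ.image (fun i : Fin (D + 1) => ((v - Pi.single i 1, i) : Edge D)),
          f e := by
      rw [Finset.sum_image]
      intro i _ j _ hij
      exact (Prod.ext_iff.1 hij).2
    rw [h2]
    simp only [mul_ite, mul_one, mul_zero]
    rw [← Finset.sum_filter]
    refine Finset.sum_subset_zero_on_sdiff ?_ ?_ fun _ _ => rfl
    · rintro ⟨x, i⟩ he
      replace he := (Finset.mem_filter.1 he).2
      simp only [upperEnd] at he
      simp only [Finset.mem_image, Finset.mem_univ, true_and]
      exact ⟨i, by rw [← he]; simp⟩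
    · intro e he
      rw [Finset.mem_sdiff] at he
      obtain ⟨i, _, rfl⟩ := Finset.mem_image.1 he.1
      by_contra hne
      exact he.2 (Finset.mem_filter.2 ⟨h _ hne (Or.inr (by simp [upperEnd])), by simp [upperEnd]⟩)
  have h1' : ∑ e ∈ A, f e * (if lowerEnd e = v then 1 else 0) = ∑ i, f (v, i) := by
    have h2 : ∑ i, f (v, i) =
        ∑ e ∈ Finset.univ.image (fun i : Fin (D + 1) => ((v, i) : Edge D)), f e := by
      rw [Finset.sum_image]
      intro i _ j _ hij
      exact (Prod.ext_iff.1 hij).2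
    rw [h2]
    simp only [mul_ite, mul_one, mul_zero]
    rw [← Finset.sum_filter]
    refine Finset.sum_subset_zero_on_sdiff ?_ ?_ fun _ _ => rfl
    · rintro ⟨x, i⟩ he
      replace he := (Finset.mem_filter.1 he).2
      simp only [lowerEnd] at he
      simp only [Finset.mem_image, Finset.mem_univ, true_and]
      exact ⟨i, by rw [← he]⟩
    · intro e he
      rw [Finset.mem_sdiff] at he
      obtain ⟨i, _, rfl⟩ := Finset.mem_image.1 he.1
      by_contra hne
      exact he.2 (Finset.mem_filter.2 ⟨h _ hne (Or.inl (by simp [lowerEnd])), by simp [lowerEnd]⟩)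
  simp only [netDiv, netInflow, mul_sub, Finset.sum_sub_distrib, h1, h1']

/-! ### Streams and signed flows -/

/-- The signed form of a stream: the amount counts negatively when the fluid goes from `upperEnd e`
to `lowerEnd e`. -/
noncomputable def signedFlow (g : Edge D → ℝ) (o : Edge D → Vertex D × Vertex D) (e : Edge D) : ℝ :=
  if o e = (lowerEnd e, upperEnd e) then g e else -g e

theorem abs_signedFlow {t : Edge D → ℝ≥0} {k : Fin D → ℕ} {m : ℕ} {g : Edge D → ℝ}
    {o : Edge D → Vertex D × Vertex D} (h : IsStream t k m g o) (e : Edge D) :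
    |signedFlow g o e| = g e := by
  unfold signedFlow
  split_ifs <;> simp [abs_of_nonneg (h.nonneg e)]

/-- The net amount brought by a stream to the vertices satisfying `p`, in signed form. -/
theorem sum_stream_eq (A : Finset (Edge D)) (p : Vertex D → Prop) [DecidablePred p] {g : Edge D → ℝ}
    {o : Edge D → Vertex D × Vertex D}
    (ho : ∀ e, o e = (lowerEnd e, upperEnd e) ∨ o e = (upperEnd e, lowerEnd e)) :
    ∑ e ∈ A.filter (fun e => ¬ p (o e).1 ∧ p (o e).2), g e -
      ∑ e ∈ A.filter (fun e => p (o e).1 ∧ ¬ p (o e).2), g e =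
    ∑ e ∈ A, signedFlow g o e *
      ((if p (upperEnd e) then 1 else 0) - (if p (lowerEnd e) then 1 else 0)) := by
  rw [Finset.sum_filter, Finset.sum_filter, ← Finset.sum_sub_distrib]
  refine Finset.sum_congr rfl fun e _ => ?_
  have hne := lowerEnd_ne_upperEnd e
  rcases ho e with h | h
  · simp only [signedFlow, h, if_true]
    by_cases h1 : p (lowerEnd e) <;> by_cases h2 : p (upperEnd e) <;> simp [h1, h2]
  · have h3 : ¬ (upperEnd e, lowerEnd e) = (lowerEnd e, upperEnd e) := by
      intro h3; exact hne (Prod.ext_iff.1 h3).2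
    simp only [signedFlow, h, if_neg h3]
    by_cases h1 : p (lowerEnd e) <;> by_cases h2 : p (upperEnd e) <;> simp [h1, h2]

theorem flow_eq_sum_netDiv (k : Fin D → ℕ) (m : ℕ) {g : Edge D → ℝ}
    {o : Edge D → Vertex D × Vertex D}
    (ho : ∀ e, o e = (lowerEnd e, upperEnd e) ∨ o e = (upperEnd e, lowerEnd e)) :
    flow k m g o =
      ∑ w ∈ topFace k m, netDiv (boxEdges k m) lowerEnd upperEnd (signedFlow g o) w := by
  rw [sum_netDiv, flow]
  exact sum_stream_eq _ (fun v => v ∈ topFace k m) ho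

theorem balance_iff (A : Finset (Edge D)) (v : Vertex D) {g : Edge D → ℝ}
    {o : Edge D → Vertex D × Vertex D}
    (ho : ∀ e, o e = (lowerEnd e, upperEnd e) ∨ o e = (upperEnd e, lowerEnd e)) :
    (∑ e ∈ A.filter (fun e => (o e).1 = v), g e = ∑ e ∈ A.filter (fun e => (o e).2 = v), g e) ↔
      netDiv A lowerEnd upperEnd (signedFlow g o) v = 0 := by
  have h := sum_stream_eq A (fun w => w = v) (g := g) ho
  have h1 : A.filter (fun e => ¬ (o e).1 = v ∧ (o e).2 = v) = A.filter (fun e => (o e).2 = v) := by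
    refine Finset.filter_congr fun e _ => ⟨fun h => h.2, fun h2 => ⟨fun h1 => ?_, h2⟩⟩
    have := lowerEnd_ne_upperEnd e
    rcases ho e with h3 | h3 <;> rw [h3] at h1 h2 <;> simp_all
  have h2 : A.filter (fun e => (o e).1 = v ∧ ¬ (o e).2 = v) = A.filter (fun e => (o e).1 = v) := by
    refine Finset.filter_congr fun e _ => ⟨fun h => h.1, fun h2 => ⟨h2, fun h1 => ?_⟩⟩
    have := lowerEnd_ne_upperEnd e
    rcases ho e with h3 | h3 <;> rw [h3] at h1 h2 <;> simp_all
  rw [h1, h2] at h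
  rw [netDiv, ← h, sub_eq_zero, eq_comm]

theorem mem_slab_of_mem_boxEdges {k : Fin D → ℕ} {m : ℕ} {e : Edge D} (he : e ∈ boxEdges k m) :
    lowerEnd e ∈ slab k (Finset.Icc 0 (m : ℤ)) ∧ upperEnd e ∈ slab k (Finset.Icc 0 (m : ℤ)) :=
  ⟨(mem_boxEdges.1 he).1, (mem_boxEdges.1 he).2.1⟩

theorem mem_box_sdiff_topFace {k : Fin D → ℕ} {m : ℕ} {v : Vertex D} :
    v ∈ box k m \ topFace k m ↔
      v ∈ slab k (Finset.Icc 0 (m : ℤ)) ∧ v ∉ bottomFace k ∧ v ∉ topFace k m := by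
  simp only [Finset.mem_sdiff, box, topFace, bottomFace, mem_slab, Finset.mem_Ioc, Finset.mem_Icc,
    Finset.mem_singleton]
  constructor
  · rintro ⟨⟨h1, h2⟩, h3⟩
    exact ⟨⟨h1, by omega⟩, fun h => by omega, h3⟩
  · rintro ⟨⟨h1, h2⟩, h3, h4⟩
    refine ⟨⟨h1, ?_⟩, h4⟩
    have : height v ≠ 0 := fun h => h3 ⟨h1, h⟩
    omega

theorem flow_le_sum_capacity {t : Edge D → ℝ≥0} {k : Fin D → ℕ} {m : ℕ} {g : Edge D → ℝ}
    {o : Edge D → Vertex D × Vertex D} (h : IsStream t k m g o) :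
    flow k m g o ≤
      ∑ e ∈ boxEdges k m with e.2 = Fin.last D ∧ upperEnd e ∈ topFace k m, (t e : ℝ) := by
  rw [flow_eq_sum_netDiv k m h.orientation, sum_netDiv, Finset.sum_filter]
  refine Finset.sum_le_sum fun e he => ?_
  have h1 := (le_abs_self _).trans ((abs_signedFlow h e).trans_le (h.le_capacity e he))
  have h1' := (neg_le_abs _).trans ((abs_signedFlow h e).trans_le (h.le_capacity e he))
  have h2 := mem_boxEdges.1 he
  have h3 := height_upperEnd e
  have h4 := (t e).2
  have h5 : (if e.2 = Fin.last D ∧ upperEnd e ∈ topFace k m then (t e : ℝ) else 0) ≥ 0 := by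
    split_ifs <;> simp
  by_cases hu : upperEnd e ∈ topFace k m <;> by_cases hl : lowerEnd e ∈ topFace k m
  · simpa [hu, hl] using h5
  · have h6 : e.2 = Fin.last D := by
      by_contra h6
      rw [if_neg h6, add_zero] at h3
      simp only [topFace, mem_slab, Finset.mem_singleton] at hu hl
      exact hl ⟨(mem_slab.1 h2.1).1, h3 ▸ hu.2⟩
    simpa [hu, hl, h6] using h1
  · exfalso
    simp only [topFace, mem_slab, Finset.mem_singleton, Finset.mem_Icc] at hu hl h2
    split_ifs at h3
    · omega
    · exact hu ⟨h2.2.1.1, by omega⟩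
  · simp [hu, hl]

theorem bddAbove_flow (t : Edge D → ℝ≥0) (k : Fin D → ℕ) (m : ℕ) :
    BddAbove {a : ℝ | ∃ g o, IsStream t k m g o ∧ a = flow k m g o} := by
  refine ⟨∑ e ∈ boxEdges k m with e.2 = Fin.last D ∧ upperEnd e ∈ topFace k m, (t e : ℝ), ?_⟩
  rintro a ⟨g, o, h, rfl⟩
  exact flow_le_sum_capacity h

theorem nonempty_flow (t : Edge D → ℝ≥0) (k : Fin D → ℕ) (m : ℕ) :
    {a : ℝ | ∃ g o, IsStream t k m g o ∧ a = flow k m g o}.Nonempty :=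
  ⟨_, fun _ => 0, fun e => (lowerEnd e, upperEnd e),
    ⟨fun _ => le_rfl, fun _ => Or.inl rfl, fun _ _ => by simp, fun _ _ => by simp⟩, rfl⟩

/-! ### Conduits: flows with prescribed entries and exits -/

/-- The function on the vertices which is `a` on the hyperplane at height `z` and `0` elsewhere. -/
def layer (a : (Fin D → ℤ) → ℝ) (z : ℤ) (v : Vertex D) : ℝ :=
  if height v = z then a (base v) else 0

/-- The signed flow `f`, which vanishes off the inner edges of the box, respects the capacities `t`,
enters the box at the bottom with the amounts `a` and leaves it at the top with the amounts `b`. -/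
structure IsConduit (t : Edge D → ℝ≥0) (k : Fin D → ℕ) (m : ℕ) (a b : (Fin D → ℤ) → ℝ)
    (f : Edge D → ℝ) : Prop where
  support : ∀ e, f e ≠ 0 → e ∈ innerEdges k m
  abs_le : ∀ e, |f e| ≤ t e
  netInflow_eq : ∀ v, netInflow f v = layer b m v - layer a 0 v

theorem IsConduit.mono {t t' : Edge D → ℝ≥0} {k : Fin D → ℕ} {m : ℕ} {a b : (Fin D → ℤ) → ℝ}
    {f : Edge D → ℝ} (h : IsConduit t k m a b f) (ht : ∀ e ∈ innerEdges k m, t e ≤ t' e) :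
    IsConduit t' k m a b f := by
  refine ⟨h.support, fun e => ?_, h.netInflow_eq⟩
  by_cases hf : f e = 0
  · simp [hf]
  · exact (h.abs_le e).trans (NNReal.coe_le_coe.2 (ht e (h.support e hf)))

theorem snoc_base_height (v : Vertex D) :
    (Fin.snoc (α := fun _ => ℤ) (base v) (height v) : Vertex D) = v :=
  Fin.snoc_init_self v

theorem base_snoc (x : Fin D → ℤ) (z : ℤ) :
    base (Fin.snoc (α := fun _ => ℤ) x z : Vertex D) = x := by
  funext i; simp [base]

theorem height_snoc (x : Fin D → ℤ) (z : ℤ) :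
    height (Fin.snoc (α := fun _ => ℤ) x z : Vertex D) = z := by
  simp [height]

theorem sum_slab_singleton {R : Type*} [AddCommMonoid R] (k : Fin D → ℕ) (z : ℤ)
    (F : Vertex D → R) :
    ∑ v ∈ slab k {z}, F v = ∑ x ∈ crossSection k, F (Fin.snoc (α := fun _ => ℤ) x z) := by
  refine Finset.sum_bij' (fun v _ => base v) (fun x _ => Fin.snoc (α := fun _ => ℤ) x z)
    ?_ ?_ ?_ ?_ ?_
  · intro v hv; exact (mem_slab.1 hv).1
  · intro x hx; rw [mem_slab, base_snoc, height_snoc]; simpa using hx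
  · intro v hv
    have h := (mem_slab.1 hv).2
    rw [Finset.mem_singleton] at h
    change Fin.snoc (α := fun _ => ℤ) (base v) z = v
    rw [← h, snoc_base_height]
  · intro x _; exact base_snoc x z
  · intro v hv
    have h := (mem_slab.1 hv).2
    rw [Finset.mem_singleton] at h
    change F v = F (Fin.snoc (α := fun _ => ℤ) (base v) z)
    rw [← h, snoc_base_height]

theorem disjoint_bottomFace_topFace (k : Fin D → ℕ) {m : ℕ} (hm : 1 ≤ m) :
    Disjoint (bottomFace k) (topFace k m) := by
  rw [Finset.disjoint_left]
  intro v h1 h2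
  simp only [bottomFace, topFace, mem_slab, Finset.mem_singleton] at h1 h2
  omega

theorem bottomFace_subset_slab (k : Fin D → ℕ) (m : ℕ) :
    bottomFace k ⊆ slab k (Finset.Icc 0 (m : ℤ)) := by
  intro v h
  simp only [bottomFace, mem_slab, Finset.mem_singleton, Finset.mem_Icc] at h ⊢
  exact ⟨h.1, by omega⟩

theorem topFace_subset_slab (k : Fin D → ℕ) (m : ℕ) :
    topFace k m ⊆ slab k (Finset.Icc 0 (m : ℤ)) := by
  intro v h
  simp only [topFace, mem_slab, Finset.mem_singleton, Finset.mem_Icc] at h ⊢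
  exact ⟨h.1, by omega⟩

/-- The entries of a flow in the box are carried to its top; `h` may be any height up to `m`, since
the net amounts crossing the horizontal hyperplanes between bottom and top are all the same. -/
theorem IsConduit.sum_le_maxFlow {t : Edge D → ℝ≥0} {k : Fin D → ℕ} {m : ℕ}
    {a b : (Fin D → ℤ) → ℝ} {f : Edge D → ℝ} (hf : IsConduit t k m a b f) {h : ℕ} (h1 : 1 ≤ h)
    (hm : h ≤ m) : ∑ x ∈ crossSection k, a x ≤ maxFlow t k h := by
  classical
  let o : Edge D → Vertex D × Vertex D := fun e =>
    if 0 ≤ f e then (lowerEnd e, upperEnd e) else (upperEnd e, lowerEnd e)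
  have ho : ∀ e, o e = (lowerEnd e, upperEnd e) ∨ o e = (upperEnd e, lowerEnd e) := by
    intro e; simp only [o]; split_ifs <;> simp
  have hsigned : signedFlow (fun e => |f e|) o = f := by
    funext e
    by_cases h0 : 0 ≤ f e
    · simp [signedFlow, o, h0, abs_of_nonneg]
    · have h3 : ¬ (upperEnd e, lowerEnd e) = (lowerEnd e, upperEnd e) := by
        intro h3; exact lowerEnd_ne_upperEnd e (Prod.ext_iff.1 h3).2
      simp only [signedFlow, o, if_neg h0, if_neg h3]
      rw [abs_of_neg (not_le.1 h0), neg_neg]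
  -- below the height `h`, the edges that carry fluid are edges of the smaller box
  have hdiv : ∀ v : Vertex D, height v < h →
      netDiv (boxEdges k h) lowerEnd upperEnd f v = layer b m v - layer a 0 v := by
    intro v hv
    rw [netDiv_eq_netInflow, hf.netInflow_eq]
    intro e hne hinc
    have h2 := mem_innerEdges.1 (hf.support e hne)
    have h3 := height_upperEnd e
    have h4 := heightSum_eq e
    simp only [mem_boxEdges, mem_slab, Finset.mem_Icc]
    have h5 : height (lowerEnd e) = height v ∨ height (upperEnd e) = height v :=
      hinc.imp (congrArg height) (congrArg height)
    split_ifs at h3 h4 <;> exact ⟨⟨h2.1, by omega⟩, ⟨h2.2.1, by omega⟩, h2.2.2.1⟩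
  have hzero : ∀ w ∈ slab k (Finset.Icc 0 (h : ℤ)), w ∉ bottomFace k → w ∉ topFace k h →
      netDiv (boxEdges k h) lowerEnd upperEnd f w = 0 := by
    intro w hw hwB hwT
    simp only [mem_slab, Finset.mem_Icc, bottomFace, topFace, Finset.mem_singleton] at hw hwB hwT
    have hw0 : height w ≠ 0 := fun h => hwB ⟨hw.1, h⟩
    have hwh : height w ≠ h := fun h => hwT ⟨hw.1, h⟩
    rw [hdiv w (by omega), layer, layer, if_neg (by omega), if_neg hw0, sub_zero]
  have hstream : IsStream t k h (fun e => |f e|) o := by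
    refine ⟨fun e => abs_nonneg _, ho, fun e _ => hf.abs_le e, fun v hv => ?_⟩
    rw [balance_iff _ _ ho, hsigned]
    obtain ⟨h2, h3, h4⟩ := mem_box_sdiff_topFace.1 hv
    exact hzero v h2 h3 h4
  refine le_csSup (bddAbove_flow t k h) ⟨_, o, hstream, ?_⟩
  rw [flow_eq_sum_netDiv k h ho, hsigned]
  have hcut := sum_netDiv_sink_eq_cut (fun e he => (mem_slab_of_mem_boxEdges he).1)
    (fun e he => (mem_slab_of_mem_boxEdges he).2) (topFace_subset_slab k h)
    (subset_refl (bottomFace k)) (disjoint_bottomFace_topFace k h1) f hzero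
  have hneg : ∑ w ∈ bottomFace k, netDiv (boxEdges k h) lowerEnd upperEnd f w =
      -∑ w ∈ topFace k h, netDiv (boxEdges k h) lowerEnd upperEnd f w := by
    rw [hcut, sum_netDiv, ← Finset.sum_neg_distrib]
    exact Finset.sum_congr rfl fun e _ => by ring
  rw [← neg_eq_iff_eq_neg] at hneg
  rw [← hneg, bottomFace, sum_slab_singleton, ← Finset.sum_neg_distrib]
  refine Finset.sum_congr rfl fun x _ => ?_
  rw [hdiv _ (by rw [height_snoc]; omega), layer, layer, height_snoc, base_snoc,
    if_neg (by omega), if_pos rfl, zero_sub, neg_neg]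

theorem topFace_of_mem_boxEdges_not_mem_innerEdges {k : Fin D → ℕ} {m : ℕ} {e : Edge D}
    (he : e ∈ boxEdges k m) (he' : e ∉ innerEdges k m) :
    lowerEnd e ∈ topFace k m ∧ upperEnd e ∈ topFace k m := by
  have h1 := mem_boxEdges.1 he
  have h2 : ¬ heightSum e < 2 * m := fun h => he' (Finset.mem_filter.2 ⟨he, h⟩)
  simp only [topFace, mem_slab, Finset.mem_singleton, Finset.mem_Icc, heightSum] at *
  exact ⟨⟨h1.1.1, by omega⟩, ⟨h1.2.1.1, by omega⟩⟩

theorem sum_topFace_netDiv_innerEdges (k : Fin D → ℕ) (m : ℕ) (f : Edge D → ℝ) :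
    ∑ w ∈ topFace k m, netDiv (innerEdges k m) lowerEnd upperEnd f w =
      ∑ w ∈ topFace k m, netDiv (boxEdges k m) lowerEnd upperEnd f w := by
  rw [sum_netDiv, sum_netDiv]
  refine Finset.sum_subset (Finset.filter_subset _ _) fun e he he' => ?_
  have := topFace_of_mem_boxEdges_not_mem_innerEdges he he'
  simp [this.1, this.2]

theorem netDiv_innerEdges {k : Fin D → ℕ} {m : ℕ} (f : Edge D → ℝ) {w : Vertex D}
    (hw : w ∉ topFace k m) : netDiv (innerEdges k m) lowerEnd upperEnd f w =
      netDiv (boxEdges k m) lowerEnd upperEnd f w := by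
  refine Finset.sum_subset (Finset.filter_subset _ _) fun e he he' => ?_
  have := topFace_of_mem_boxEdges_not_mem_innerEdges he he'
  have h1 : upperEnd e ≠ w := fun h => hw (h ▸ this.2)
  have h2 : lowerEnd e ≠ w := fun h => hw (h ▸ this.1)
  simp [h1, h2]

theorem abs_netInflow_le {f : Edge D → ℝ} {C : ℝ} (h : ∀ e, |f e| ≤ C) (v : Vertex D) :
    |netInflow f v| ≤ 2 * (D + 1) * C := by
  refine (Finset.abs_sum_le_sum_abs _ _).trans ?_
  have h1 : ∀ i ∈ (Finset.univ : Finset (Fin (D + 1))),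
      |f (v - Pi.single i 1, i) - f (v, i)| ≤ 2 * C := fun i _ =>
    (abs_sub _ _).trans (by linarith [h (v - Pi.single i 1, i), h (v, i)])
  refine (Finset.sum_le_card_nsmul _ _ _ h1).trans (le_of_eq ?_)
  simp; ring

/-- The conduits whose entries and exits are multiples of `1 / κ` and bounded by a multiple of the
required flow are enough to realize a maximal flow. This keeps the number of boundary conditions
finite although the capacities need not be bounded. -/
theorem exists_conduit_of_le_maxFlow {t : Edge D → ℝ≥0} {k : Fin D → ℕ} {m : ℕ} (hm : 1 ≤ m)
    {κ : ℝ≥0} (hκ : 0 < κ) {L : ℝ} (hL : L ≤ maxFlow (discretize κ t) k m) {N : ℕ}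
    (hN : (N : ℝ) - 1 < κ * L) :
    ∃ α β : (Fin D → ℤ) → ℤ, (∀ x, |α x| ≤ 2 * (D + 1) * N) ∧ (∀ x, |β x| ≤ 2 * (D + 1) * N) ∧
      (∀ x, x ∉ crossSection k → α x = 0) ∧ (∀ x, x ∉ crossSection k → β x = 0) ∧
      (N : ℤ) ≤ ∑ x ∈ crossSection k, α x ∧
      ∃ f, IsConduit (discretize κ t) k m (fun x => α x / κ) (fun x => β x / κ) f := by
  classical
  have hκ' : (0 : ℝ) < κ := hκ
  obtain ⟨_, ⟨g, o, hgo, rfl⟩, hval⟩ := exists_lt_of_lt_csSup (nonempty_flow (discretize κ t) k m)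
    (show ((N : ℝ) - 1) / κ < maxFlow (discretize κ t) k m from
      ((div_lt_iff₀' hκ').2 hN).trans_le hL)
  have hsub : innerEdges k m ⊆ boxEdges k m := Finset.filter_subset _ _
  have hW1 : ∀ e ∈ innerEdges k m, lowerEnd e ∈ slab k (Finset.Icc 0 (m : ℤ)) := fun e he =>
    (mem_slab_of_mem_boxEdges (hsub he)).1
  have hW2 : ∀ e ∈ innerEdges k m, upperEnd e ∈ slab k (Finset.Icc 0 (m : ℤ)) := fun e he =>
    (mem_slab_of_mem_boxEdges (hsub he)).2
  have hscale : ∀ w, netDiv (innerEdges k m) lowerEnd upperEnd (fun e => κ * signedFlow g o e) w =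
      κ * netDiv (innerEdges k m) lowerEnd upperEnd (signedFlow g o) w := by
    intro w
    simp only [netDiv, Finset.mul_sum, mul_assoc]
  obtain ⟨f, hfc, hfdiv, hfval⟩ := exists_integral_flow hW1 hW2 (bottomFace_subset_slab k m)
    (topFace_subset_slab k m) (disjoint_bottomFace_topFace k hm) (fun e => ⌊κ * t e⌋₊) N
    (fun e => κ * signedFlow g o e)
    (by
      intro e he
      rw [abs_mul, abs_signedFlow hgo, abs_of_pos hκ']
      have := hgo.le_capacity e (hsub he)
      rw [discretize, NNReal.coe_div, le_div_iff₀' hκ'] at this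
      exact_mod_cast this)
    (by
      intro w hw hwB hwT
      rw [hscale, netDiv_innerEdges _ hwT, (balance_iff _ _ hgo.orientation).1
        (hgo.balance w (mem_box_sdiff_topFace.2 ⟨hw, hwB, hwT⟩)), mul_zero])
    (by
      simp only [hscale]
      rw [← Finset.mul_sum, sum_topFace_netDiv_innerEdges, ← flow_eq_sum_netDiv k m hgo.orientation]
      exact (div_lt_iff₀' hκ').1 hval)
  let φ : Edge D → ℝ := fun e => if e ∈ innerEdges k m then (f e : ℝ) / κ else 0
  have hφ : ∀ v, netInflow φ v =
      ((netDiv (innerEdges k m) lowerEnd upperEnd f v : ℤ) : ℝ) / κ := by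
    intro v
    rw [← netDiv_eq_netInflow (A := innerEdges k m)]
    · simp only [netDiv]
      push_cast
      rw [Finset.sum_div]
      refine Finset.sum_congr rfl fun e he => ?_
      simp only [φ, if_pos he]
      ring
    · intro e he _
      by_contra h
      exact he (if_neg h)
  have hbound : ∀ v, |netDiv (innerEdges k m) lowerEnd upperEnd f v| ≤ 2 * (D + 1) * N := by
    intro v
    have h1 : |netInflow φ v| ≤ 2 * (D + 1) * (N / κ) := by
      refine abs_netInflow_le (fun e => ?_) v
      simp only [φ]
      split_ifs with he
      · rw [abs_div, abs_of_pos hκ']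
        gcongr
        exact_mod_cast (le_min_iff.1 (hfc e he)).2
      · simp; positivity
    rw [hφ, abs_div, abs_of_pos hκ', ← mul_div_assoc, div_le_div_iff_of_pos_right hκ'] at h1
    exact_mod_cast h1
  have hout : ∀ v, base v ∉ crossSection k →
      netDiv (innerEdges k m) lowerEnd upperEnd f v = 0 := by
    intro v hv
    refine Finset.sum_eq_zero fun e he => ?_
    have h1 := mem_innerEdges.1 he
    have h2 : upperEnd e ≠ v := fun h => hv (h ▸ h1.2.1)
    have h3 : lowerEnd e ≠ v := fun h => hv (h ▸ h1.1)
    simp [h2, h3]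
  refine ⟨fun x => -netDiv (innerEdges k m) lowerEnd upperEnd f (Fin.snoc (α := fun _ => ℤ) x 0),
    fun x => netDiv (innerEdges k m) lowerEnd upperEnd f (Fin.snoc (α := fun _ => ℤ) x m),
    fun x => by rw [abs_neg]; exact hbound _, fun x => hbound _,
    fun x hx => neg_eq_zero.2 (hout _ (by rwa [base_snoc])),
    fun x hx => hout _ (by rwa [base_snoc]), ?_, φ, ?_, ?_, ?_⟩
  · rw [Finset.sum_neg_distrib, ← sum_slab_singleton]
    refine hfval.trans (le_of_eq ?_)
    rw [sum_netDiv_sink_eq_cut hW1 hW2 (topFace_subset_slab k m)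
      (subset_refl (bottomFace k)) (disjoint_bottomFace_topFace k hm) f hfdiv,
      sum_netDiv, ← Finset.sum_neg_distrib]
    exact Finset.sum_congr rfl fun e _ => by rw [bottomFace]; ring
  · intro e he
    by_contra h
    exact he (if_neg h)
  · intro e
    simp only [φ]
    split_ifs with he
    · rw [abs_div, abs_of_pos hκ', discretize, NNReal.coe_div]
      gcongr
      have := (le_min_iff.1 (hfc e he)).1
      rw [NNReal.coe_natCast]
      exact_mod_cast this
    · simp
  · intro v
    rw [hφ, layer, layer]
    by_cases h0 : height v = 0
    · rw [if_neg (by omega), if_pos h0, ← h0]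
      beta_reduce
      rw [snoc_base_height]
      push_cast; ring
    · by_cases h1 : height v = m
      · rw [if_pos h1, if_neg h0, ← h1]
        beta_reduce
        rw [snoc_base_height, sub_zero]
      · rw [if_neg h1, if_neg h0, sub_zero]
        by_cases hv : base v ∈ crossSection k
        · by_cases hv' : height v ∈ Finset.Icc 0 (m : ℤ)
          · rw [hfdiv v (mem_slab.2 ⟨hv, hv'⟩)]
            · simp
            · simp [bottomFace, mem_slab, h0]
            · simp [topFace, mem_slab, h1]
          · have : netDiv (innerEdges k m) lowerEnd upperEnd f v = 0 := by
              refine Finset.sum_eq_zero fun e he => ?_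
              have h2 : upperEnd e ≠ v := fun h => hv' (h ▸ (mem_slab.1 (hW2 e he)).2)
              have h3 : lowerEnd e ≠ v := fun h => hv' (h ▸ (mem_slab.1 (hW1 e he)).2)
              simp [h2, h3]
            rw [this]; simp
        · rw [hout v hv]; simp

/-! ### Reflection and translation of conduits -/

/-- The reflection of the lattice which exchanges the heights `0` and `m`. -/
def reflectVertex (m : ℕ) (v : Vertex D) : Vertex D := Function.update v (Fin.last D) (m - height v)

theorem height_reflectVertex (m : ℕ) (v : Vertex D) :
    height (reflectVertex m v) = m - height v := by
  simp [reflectVertex, height]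

theorem base_reflectVertex (m : ℕ) (v : Vertex D) : base (reflectVertex m v) = base v := by
  funext i
  simp [reflectVertex, base]

theorem reflectVertex_reflectVertex (m : ℕ) (v : Vertex D) :
    reflectVertex m (reflectVertex m v) = v := by
  rw [← snoc_base_height (reflectVertex m (reflectVertex m v)), base_reflectVertex,
    base_reflectVertex, height_reflectVertex, height_reflectVertex, sub_sub_cancel,
    snoc_base_height]

theorem reflectVertex_sub_single_castSucc (m : ℕ) (v : Vertex D) (i : Fin D) :
    reflectVertex m (v - Pi.single i.castSucc 1) = reflectVertex m v - Pi.single i.castSucc 1 := by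
  funext j
  by_cases hj : j = Fin.last D
  · subst hj
    simp [reflectVertex, height]
  · simp [reflectVertex, Function.update_of_ne hj]

theorem reflectVertex_sub_single_last (m : ℕ) (v : Vertex D) :
    reflectVertex m (v - Pi.single (Fin.last D) 1) =
      reflectVertex m v + Pi.single (Fin.last D) 1 := by
  funext j
  by_cases hj : j = Fin.last D
  · subst hj
    simp [reflectVertex, height]; ring
  · simp [reflectVertex, Function.update_of_ne hj, Pi.single_eq_of_ne hj]

/-- The reflected edge; for a vertical edge the two endpoints change roles. -/
def reflectEdge (m : ℕ) (e : Edge D) : Edge D :=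
  (if e.2 = Fin.last D then reflectVertex m (upperEnd e) else reflectVertex m e.1, e.2)

theorem ends_reflectEdge_last (m : ℕ) {e : Edge D} (he : e.2 = Fin.last D) :
    lowerEnd (reflectEdge m e) = reflectVertex m (upperEnd e) ∧
      upperEnd (reflectEdge m e) = reflectVertex m (lowerEnd e) := by
  have h1 : lowerEnd (reflectEdge m e) = reflectVertex m (upperEnd e) := by
    simp [lowerEnd, reflectEdge, he]
  refine ⟨h1, ?_⟩
  have h2 : lowerEnd e = upperEnd e - Pi.single (Fin.last D) 1 := by
    simp [lowerEnd, upperEnd, he]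
  have h3 : upperEnd (reflectEdge m e) =
      lowerEnd (reflectEdge m e) + Pi.single (Fin.last D) 1 := by
    simp [lowerEnd, upperEnd, reflectEdge, he]
  rw [h3, h1, h2, reflectVertex_sub_single_last]

theorem ends_reflectEdge_castSucc (m : ℕ) {e : Edge D} (he : e.2 ≠ Fin.last D) :
    lowerEnd (reflectEdge m e) = reflectVertex m (lowerEnd e) ∧
      upperEnd (reflectEdge m e) = reflectVertex m (upperEnd e) := by
  have h1 : lowerEnd (reflectEdge m e) = reflectVertex m (lowerEnd e) := by
    simp [lowerEnd, reflectEdge, he]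
  refine ⟨h1, ?_⟩
  obtain ⟨i, hi⟩ := Fin.exists_castSucc_eq.2 he
  have h2 : lowerEnd e = upperEnd e - Pi.single i.castSucc 1 := by
    simp [lowerEnd, upperEnd, hi]
  have h3 : upperEnd (reflectEdge m e) =
      lowerEnd (reflectEdge m e) + Pi.single i.castSucc 1 := by
    simp [lowerEnd, upperEnd, reflectEdge, hi]
  rw [h3, h1, h2, reflectVertex_sub_single_castSucc, sub_add_cancel]

theorem reflectEdge_involutive (m : ℕ) : Function.Involutive (reflectEdge (D := D) m) := by
  intro e
  have h2 : (reflectEdge m e).2 = e.2 := rfl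
  refine Prod.ext ?_ rfl
  change lowerEnd (reflectEdge m (reflectEdge m e)) = lowerEnd e
  by_cases he : e.2 = Fin.last D
  · rw [(ends_reflectEdge_last m (h2.trans he)).1, (ends_reflectEdge_last m he).2,
      reflectVertex_reflectVertex]
  · rw [(ends_reflectEdge_castSucc m (h2 ▸ he)).1, (ends_reflectEdge_castSucc m he).1,
      reflectVertex_reflectVertex]

/-- Turning a box upside down and reversing the flow exchanges entries and exits. -/
theorem IsConduit.reflect {t : Edge D → ℝ≥0} {k : Fin D → ℕ} {m : ℕ} {a b : (Fin D → ℤ) → ℝ}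
    {f : Edge D → ℝ} (h : IsConduit t k m a b f) :
    ∃ f', IsConduit (fun e => t (reflectEdge m e)) k m b a f' := by
  refine ⟨fun e => (if e.2 = Fin.last D then 1 else -1) * f (reflectEdge m e), fun e he => ?_,
    fun e => ?_, fun v => ?_⟩
  · have h1 := mem_innerEdges.1 (h.support _ (right_ne_zero_of_mul he))
    rw [mem_innerEdges]
    simp only [heightSum] at h1 ⊢
    by_cases hl : e.2 = Fin.last D
    · rw [(ends_reflectEdge_last m hl).1, (ends_reflectEdge_last m hl).2] at h1
      simp only [base_reflectVertex, height_reflectVertex] at h1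
      exact ⟨h1.2.1, h1.1, by omega, by omega⟩
    · rw [(ends_reflectEdge_castSucc m hl).1, (ends_reflectEdge_castSucc m hl).2] at h1
      simp only [base_reflectVertex, height_reflectVertex] at h1
      exact ⟨h1.1, h1.2.1, by omega, by omega⟩
  · refine le_trans (le_of_eq ?_) (h.abs_le (reflectEdge m e))
    split_ifs <;> simp
  · have h1 : netInflow (fun e => (if e.2 = Fin.last D then 1 else -1) * f (reflectEdge m e)) v =
        -netInflow f (reflectVertex m v) := by
      simp only [netInflow, ← Finset.sum_neg_distrib]
      refine Finset.sum_congr rfl fun i _ => ?_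
      by_cases hi : i = Fin.last D
      · subst hi
        have h2 : reflectVertex m (v + Pi.single (Fin.last D) 1) =
            reflectVertex m v - Pi.single (Fin.last D) 1 := by
          rw [eq_sub_iff_add_eq, ← reflectVertex_sub_single_last, add_sub_cancel_right]
        simp [reflectEdge, upperEnd, h2]
      · obtain ⟨j, rfl⟩ := Fin.exists_castSucc_eq.2 hi
        simp only [reflectEdge, hi, if_false, reflectVertex_sub_single_castSucc]
        ring
    rw [h1, h.netInflow_eq, neg_sub]
    simp only [layer, height_reflectVertex, base_reflectVertex]
    congr 1
    · exact if_congr (by omega) rfl rfl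
    · exact if_congr (by omega) rfl rfl

/-- Translation of the edges of the lattice by `w`. -/
def translateEdge (w : Vertex D) (e : Edge D) : Edge D := (e.1 + w, e.2)

theorem translateEdge_neg_left (w : Vertex D) (e : Edge D) :
    translateEdge (-w) (translateEdge w e) = e := by
  simp [translateEdge]

theorem translateEdge_neg_right (w : Vertex D) (e : Edge D) :
    translateEdge w (translateEdge (-w) e) = e := by
  simp [translateEdge]

theorem netInflow_translate (f : Edge D → ℝ) (w v : Vertex D) :
    netInflow (fun e => f (translateEdge (-w) e)) v = netInflow f (v - w) := by
  simp only [netInflow, translateEdge]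
  refine Finset.sum_congr rfl fun i _ => ?_
  congr 3
  abel

/-! ### Gluing conduits together -/

/-- The translation that brings the box `]0, N] ^ D × ]0, M]` to its position in column `j` and
layer `k` of a tiling. -/
def cellOffset (N M : ℕ) (j : Fin D → ℕ) (k : ℕ) : Vertex D :=
  Fin.snoc (α := fun _ => ℤ) (fun i => (N * j i : ℤ)) (M * k : ℤ)

theorem base_sub_cellOffset (N M : ℕ) (j : Fin D → ℕ) (k : ℕ) (v : Vertex D) (i : Fin D) :
    base (v - cellOffset N M j k) i = base v i - N * j i := by
  simp [base, cellOffset]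

theorem height_sub_cellOffset (N M : ℕ) (j : Fin D → ℕ) (k : ℕ) (v : Vertex D) :
    height (v - cellOffset N M j k) = height v - M * k := by
  simp [height, cellOffset]

theorem lowerEnd_translateEdge (w : Vertex D) (e : Edge D) :
    lowerEnd (translateEdge (-w) e) = lowerEnd e - w := by
  simp [lowerEnd, translateEdge, sub_eq_add_neg]

theorem upperEnd_translateEdge (w : Vertex D) (e : Edge D) :
    upperEnd (translateEdge (-w) e) = upperEnd e - w := by
  simp only [upperEnd, translateEdge]; abel

theorem mem_crossSection {k : Fin D → ℕ} {x : Fin D → ℤ} :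
    x ∈ crossSection k ↔ ∀ i, 0 < x i ∧ x i ≤ k i := by
  simp [crossSection]

/-- `e` belongs to the cell of the tiling in column `j` and layer `k`. -/
def InCell (N M : ℕ) (j : Fin D → ℕ) (k : ℕ) (e : Edge D) : Prop :=
  translateEdge (-cellOffset N M j k) e ∈ innerEdges (fun _ => N) M

theorem inCell_iff {N M : ℕ} {j : Fin D → ℕ} {k : ℕ} {e : Edge D} :
    InCell N M j k e ↔
      (∀ i, 0 < base (lowerEnd e) i - N * j i ∧ base (lowerEnd e) i - N * j i ≤ N) ∧
      (∀ i, 0 < base (upperEnd e) i - N * j i ∧ base (upperEnd e) i - N * j i ≤ N) ∧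
      0 < heightSum e - 2 * M * k ∧ heightSum e - 2 * M * k < 2 * M := by
  have h : heightSum (translateEdge (-cellOffset N M j k) e) = heightSum e - 2 * M * k := by
    rw [heightSum, lowerEnd_translateEdge, upperEnd_translateEdge, height_sub_cellOffset,
      height_sub_cellOffset, heightSum]
    ring
  rw [InCell, mem_innerEdges, lowerEnd_translateEdge, upperEnd_translateEdge, h, mem_crossSection,
    mem_crossSection]
  simp only [base_sub_cellOffset]

theorem eq_of_mem_Ioc_sub_mul {x N : ℤ} {a b : ℕ} (ha : 0 < x - N * a ∧ x - N * a ≤ N)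
    (hb : 0 < x - N * b ∧ x - N * b ≤ N) : a = b := by
  have hN : 0 < N := ha.1.trans_le ha.2
  rcases lt_trichotomy a b with h | h | h
  · have : N * ((a : ℤ) + 1) ≤ N * b := mul_le_mul_of_nonneg_left (by omega) hN.le
    linarith
  · exact h
  · have : N * ((b : ℤ) + 1) ≤ N * a := mul_le_mul_of_nonneg_left (by omega) hN.le
    linarith

/-- The cells of the tiling have no edges in common. -/
theorem InCell.unique {N M : ℕ} {j j' : Fin D → ℕ} {k k' : ℕ} {e : Edge D}
    (h : InCell N M j k e) (h' : InCell N M j' k' e) : j = j' ∧ k = k' := by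
  rw [inCell_iff] at h h'
  refine ⟨funext fun i => eq_of_mem_Ioc_sub_mul (h.1 i) (h'.1 i), ?_⟩
  exact eq_of_mem_Ioc_sub_mul (x := heightSum e) (N := 2 * M) ⟨h.2.2.1, h.2.2.2.le⟩
    ⟨h'.2.2.1, h'.2.2.2.le⟩

theorem column_subset {N q : ℕ} {j : Fin D → ℕ} (hj : ∀ i, j i < q) {x : Fin D → ℤ}
    (hx : ∀ i, 0 < x i - N * j i ∧ x i - N * j i ≤ N) : x ∈ crossSection (fun _ => q * N) := by
  rw [mem_crossSection]
  intro i
  have h1 : (N : ℤ) * (j i + 1) ≤ N * q :=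
    mul_le_mul_of_nonneg_left (by exact_mod_cast hj i) (by positivity)
  have h2 : (0 : ℤ) ≤ N * j i := by positivity
  have := hx i
  constructor
  · linarith
  · push_cast; linarith

/-- The part of the section `]0, n] ^ D` outside the columns of the tiling. -/
noncomputable def fringe (D n r : ℕ) : Finset (Fin D → ℤ) :=
  crossSection (fun _ => n) \ crossSection (fun _ => r)

theorem card_crossSection (D n : ℕ) : (crossSection (fun _ : Fin D => n)).card = n ^ D := by
  simp [crossSection]

theorem crossSection_mono {n r : ℕ} (h : r ≤ n) :
    crossSection (fun _ : Fin D => r) ⊆ crossSection (fun _ => n) := by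
  intro x hx
  rw [mem_crossSection] at hx ⊢
  exact fun i => ⟨(hx i).1, (hx i).2.trans (by exact_mod_cast h)⟩

theorem card_fringe {n r : ℕ} (h : r ≤ n) : (fringe D n r).card = n ^ D - r ^ D := by
  rw [fringe, Finset.card_sdiff_of_subset (crossSection_mono h), card_crossSection,
    card_crossSection]

/-- The vertical flow of intensity `l` through the base points in `Φ`, up to the height `H`. -/
noncomputable def fringeFlow (Φ : Finset (Fin D → ℤ)) (H : ℕ) (l : ℝ) (e : Edge D) : ℝ :=
  if e.2 = Fin.last D ∧ base e.1 ∈ Φ ∧ 0 ≤ height e.1 ∧ height e.1 < H then l else 0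

theorem netInflow_fringeFlow (Φ : Finset (Fin D → ℤ)) (H : ℕ) (l : ℝ) (v : Vertex D) :
    netInflow (fringeFlow Φ H l) v =
      layer (fun x => if x ∈ Φ then l else 0) H v -
        layer (fun x => if x ∈ Φ then l else 0) 0 v := by
  rw [netInflow, Finset.sum_eq_single (Fin.last D)]
  · have h1 : base (v - Pi.single (Fin.last D) 1) = base v := by
      funext i
      simp [base]
    have h2 : height (v - Pi.single (Fin.last D) 1) = height v - 1 := by simp [height]
    simp only [fringeFlow, true_and, layer, h1, h2]
    by_cases hv : base v ∈ Φ
    · simp only [hv, true_and, if_true]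
      split_ifs <;> first | omega | simp
    · simp [hv]
  · intro i _ hi
    simp [fringeFlow, hi]
  · simp

/-- The columns and layers of a tiling. -/
abbrev Cell (D q K : ℕ) : Type := (Fin D → Fin q) × Fin K

/-- Conduits in the cells of a tiling, such that the exits of each layer are the entries of the next
one, and edges of capacity at least `l` on the fringe give a conduit in the large box. -/
theorem exists_conduit_glue {t : Edge D → ℝ≥0} {N M q K n : ℕ} (hq : q * N ≤ n)
    {c : ℕ → (Fin D → ℤ) → ℝ} {l : ℝ≥0}
    (hcell : ∀ j : Cell D q K, ∃ f, IsConduit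
      (fun e => t (translateEdge (cellOffset N M (fun i => j.1 i) j.2) e)) (fun _ => N) M
      (c j.2) (c (j.2 + 1)) f)
    (hfringe : ∀ e : Edge D, e.2 = Fin.last D → base e.1 ∈ fringe D n (q * N) → 0 ≤ height e.1 →
      height e.1 < (M * K : ℕ) → l ≤ t e) :
    ∃ b f, IsConduit t (fun _ => n) (M * K)
      (fun x => ∑ j : Fin D → Fin q, c 0 (fun i => x i - N * j i) +
        if x ∈ fringe D n (q * N) then (l : ℝ) else 0) b f := by
  classical
  choose f hf using hcell
  let F : Cell D q K → Edge D → ℝ := fun j e =>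
    f j (translateEdge (-cellOffset N M (fun i => j.1 i) j.2) e)
  let G : Edge D → ℝ := fringeFlow (fringe D n (q * N)) (M * K) l
  have hF : ∀ j e, F j e ≠ 0 → InCell N M (fun i => j.1 i) j.2 e := fun j e h =>
    (hf j).support _ h
  have hF' : ∀ j e, |F j e| ≤ t e := by
    intro j e
    have := (hf j).abs_le (translateEdge (-cellOffset N M (fun i => j.1 i) j.2) e)
    rwa [translateEdge_neg_right] at this
  have hFcol : ∀ j e, F j e ≠ 0 → base (lowerEnd e) ∈ crossSection (fun _ => q * N) ∧
      base (upperEnd e) ∈ crossSection (fun _ => q * N) ∧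
        0 < heightSum e ∧ heightSum e < 2 * (M * K : ℕ) := by
    intro j e h
    have h1 := inCell_iff.1 (hF j e h)
    refine ⟨column_subset (fun i => (j.1 i).2) h1.1, column_subset (fun i => (j.1 i).2) h1.2.1, ?_⟩
    have h2 : (M : ℤ) * (j.2 + 1) ≤ M * K :=
      mul_le_mul_of_nonneg_left (by exact_mod_cast j.2.2) (by positivity)
    have h3 : (0 : ℤ) ≤ M * j.2 := by positivity
    push_cast
    constructor <;> nlinarith [h1.2.2.1, h1.2.2.2]
  have hG : ∀ e, G e ≠ 0 → e.2 = Fin.last D ∧ base e.1 ∈ fringe D n (q * N) ∧ 0 ≤ height e.1 ∧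
      height e.1 < (M * K : ℕ) ∧ G e = l := by
    intro e h
    by_cases h' : e.2 = Fin.last D ∧ base e.1 ∈ fringe D n (q * N) ∧ 0 ≤ height e.1 ∧
      height e.1 < (M * K : ℕ)
    · exact ⟨h'.1, h'.2.1, h'.2.2.1, h'.2.2.2, if_pos h'⟩
    · exact absurd (if_neg h') h
  refine ⟨fun x => ∑ j : Fin D → Fin q, c K (fun i => x i - N * j i) +
    if x ∈ fringe D n (q * N) then (l : ℝ) else 0, fun e => ∑ j, F j e + G e, ?_, ?_, ?_⟩
  · intro e he
    rw [mem_innerEdges]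
    by_cases hGe : G e = 0
    · rw [hGe, add_zero] at he
      obtain ⟨j, -, hj⟩ := Finset.exists_ne_zero_of_sum_ne_zero he
      have := hFcol j e hj
      exact ⟨crossSection_mono hq this.1, crossSection_mono hq this.2.1, this.2.2⟩
    · obtain ⟨h1, h2, h3, h4, -⟩ := hG e hGe
      have h5 : base (upperEnd e) = base (lowerEnd e) := by
        funext i
        simp [base, upperEnd, lowerEnd, h1]
      have h6 := heightSum_eq e
      rw [if_pos h1] at h6
      have h7 : base (lowerEnd e) ∈ crossSection (fun _ => n) := (Finset.mem_sdiff.1 h2).1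
      refine ⟨h7, h5 ▸ h7, ?_⟩
      rw [h6]
      change 0 ≤ height (lowerEnd e) at h3
      change height (lowerEnd e) < _ at h4
      omega
  · intro e
    by_cases hFe : ∀ j, F j e = 0
    · simp only [hFe, Finset.sum_const_zero, zero_add]
      by_cases hGe : G e = 0
      · simp [hGe]
      · obtain ⟨h1, h2, h3, h4, h5⟩ := hG e hGe
        rw [h5, abs_of_nonneg l.coe_nonneg]
        exact_mod_cast hfringe e h1 h2 h3 h4
    · push Not at hFe
      obtain ⟨j, hj⟩ := hFe
      have hGe : G e = 0 := by
        by_contra hGe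
        exact (Finset.mem_sdiff.1 (hG e hGe).2.1).2 (hFcol j e hj).1
      rw [hGe, add_zero, Finset.sum_eq_single j]
      · exact hF' j e
      · intro j' _ hne
        by_contra h
        have := (hF j e hj).unique (hF j' e h)
        refine hne (Prod.ext (funext fun i => ?_) ?_)
        · exact Fin.ext (congrFun this.1 i).symm
        · exact Fin.ext this.2.symm
      · simp
  · intro v
    rw [netInflow_add, netInflow_sum, netInflow_fringeFlow]
    have h1 : ∀ j : Cell D q K, netInflow (F j) v =
        (if height v = M * (j.2 + 1 : ℕ) then c (j.2 + 1) (fun i => base v i - N * j.1 i) else 0) -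
          if height v = M * (j.2 : ℕ) then c j.2 (fun i => base v i - N * j.1 i) else 0 := by
      intro j
      have h2 := netInflow_translate (f j) (cellOffset N M (fun i => j.1 i) j.2) v
      change netInflow (F j) v = _ at h2
      rw [h2, (hf j).netInflow_eq, layer, layer, height_sub_cellOffset]
      have h3 : base (v - cellOffset N M (fun i => (j.1 i : ℕ)) j.2) =
          fun i => base v i - N * j.1 i := funext fun i => base_sub_cellOffset _ _ _ _ _ _
      rw [h3]
      congr 1
      · refine if_congr ?_ rfl rfl
        push_cast
        constructor <;> intro h <;> linarith
      · refine if_congr ?_ rfl rfl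
        constructor <;> intro h <;> linarith
    simp only [h1]
    rw [Fintype.sum_prod_type]
    have h4 : ∀ j : Fin D → Fin q, ∑ k : Fin K,
        ((if height v = M * ((k : ℕ) + 1 : ℕ) then c (k + 1) (fun i => base v i - N * j i) else 0) -
          if height v = M * (k : ℕ) then c k (fun i => base v i - N * j i) else 0) =
        (if height v = M * K then c K (fun i => base v i - N * j i) else 0) -
          if height v = 0 then c 0 (fun i => base v i - N * j i) else 0 := by
      intro j
      rw [Fin.sum_univ_eq_sum_range (fun k =>
        ((if height v = M * (k + 1 : ℕ) then c (k + 1) (fun i => base v i - N * j i) else 0) -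
          if height v = M * (k : ℕ) then c k (fun i => base v i - N * j i) else 0)) K,
        Finset.sum_range_sub (fun k : ℕ =>
          if height v = M * (k : ℕ) then c k (fun i => base v i - N * j i) else 0)]
      simp
    simp only [h4, Finset.sum_sub_distrib, layer]
    push_cast
    simp only [Finset.sum_ite_irrel, Finset.sum_const_zero]
    split_ifs <;> ring

/-- The total entry of the glued conduit. -/
theorem sum_glued_entries {N q n : ℕ} (hq : q * N ≤ n) {a : (Fin D → ℤ) → ℝ}
    (ha : ∀ x, x ∉ crossSection (fun _ => N) → a x = 0) (l : ℝ) :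
    ∑ x ∈ crossSection (fun _ => n), (∑ j : Fin D → Fin q, a (fun i => x i - N * j i) +
      if x ∈ fringe D n (q * N) then l else 0) =
    (q : ℝ) ^ D * ∑ x ∈ crossSection (fun _ => N), a x + ((n : ℝ) ^ D - ((q : ℝ) * N) ^ D) * l := by
  rw [Finset.sum_add_distrib, Finset.sum_comm]
  congr 1
  · have h1 : ∀ j : Fin D → Fin q, ∑ x ∈ crossSection (fun _ => n), a (fun i => x i - N * j i) =
        ∑ x ∈ crossSection (fun _ => N), a x := by
      intro j
      symm
      refine Finset.sum_of_injOn (fun x i => x i + N * j i) ?_ ?_ ?_ ?_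
      · intro x _ y _ hxy
        funext i
        have := congrFun hxy i
        simpa using this
      · intro x hx
        refine crossSection_mono hq
          (column_subset (j := fun i => j i) (fun i => (j i).2) fun i => ?_)
        simpa using mem_crossSection.1 hx i
      · intro x _ hx
        refine ha _ fun h => hx ⟨_, h, ?_⟩
        funext i; simp
      · intro x _
        congr 1
        funext i; simp
    simp [h1]
  · rw [← Finset.sum_filter, Finset.sum_const, nsmul_eq_mul]
    congr 1
    have h2 : (crossSection (fun _ => n)).filter (fun x => x ∈ fringe D n (q * N)) =
        fringe D n (q * N) := by
      rw [Finset.filter_mem_eq_inter, fringe, Finset.inter_eq_right]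
      exact Finset.sdiff_subset
    rw [h2, card_fringe hq, Nat.cast_sub (Nat.pow_le_pow_left hq D)]
    push_cast; ring

/-! ### Probability of the existence of a conduit -/

/-- The law of the capacities. -/
noncomputable abbrev capacityLaw (D : ℕ) (F : Measure ℝ≥0) [IsProbabilityMeasure F] :
    Measure (Edge D → ℝ≥0) :=
  Measure.infinitePi (fun _ : Edge D => F)

/-- The σ-algebra generated by the capacities of the edges in `S`. -/
@[reducible] def edgeAlgebra (S : Set (Edge D)) : MeasurableSpace (Edge D → ℝ≥0) :=
  ⨆ e ∈ S, MeasurableSpace.comap (fun t => t e) inferInstance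

theorem edgeAlgebra_mono {S T : Set (Edge D)} (h : S ⊆ T) : edgeAlgebra S ≤ edgeAlgebra T :=
  biSup_mono h

theorem edgeAlgebra_le (S : Set (Edge D)) : edgeAlgebra S ≤ MeasurableSpace.pi :=
  iSup₂_le fun e _ => (measurable_pi_apply e).comap_le

theorem measurable_edgeAlgebra {S : Set (Edge D)} {e : Edge D} (he : e ∈ S) :
    Measurable[edgeAlgebra S] (fun t : Edge D → ℝ≥0 => t e) := by
  rw [measurable_iff_comap_le]
  exact le_iSup₂_of_le e he le_rfl

/-- Events that depend on disjoint sets of edges are independent. -/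
theorem measure_biInter_eq_prod (F : Measure ℝ≥0) [IsProbabilityMeasure F] {ι : Type*}
    {S : ι → Set (Edge D)} (hS : Pairwise fun i j => Disjoint (S i) (S j))
    {U : ι → Set (Edge D → ℝ≥0)} (hU : ∀ i, MeasurableSet[edgeAlgebra (S i)] (U i))
    (s : Finset ι) :
    capacityLaw D F (⋂ i ∈ s, U i) = ∏ i ∈ s, capacityLaw D F (U i) := by
  classical
  have hind : ProbabilityTheory.iIndep
      (fun e : Edge D => MeasurableSpace.comap (fun t : Edge D → ℝ≥0 => t e) inferInstance)
      (capacityLaw D F) :=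
    ProbabilityTheory.iIndepFun_infinitePi (X := fun _ x => x) (fun _ => measurable_id)
  have hmeas : ∀ s : Finset ι, MeasurableSet[edgeAlgebra (⋃ i ∈ s, S i)] (⋂ i ∈ s, U i) := by
    intro s
    refine Finset.measurableSet_biInter (m := edgeAlgebra (⋃ i ∈ s, S i)) s fun i hi => ?_
    exact edgeAlgebra_mono (Set.subset_biUnion_of_mem hi) _ (hU i)
  induction s using Finset.induction_on with
  | empty => simp
  | insert i s hi ih =>
    rw [Finset.prod_insert hi, Finset.set_biInter_insert, ← ih]
    have hdisj : Disjoint (S i) (⋃ j ∈ s, S j) := by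
      rw [Set.disjoint_iUnion₂_right]
      exact fun j hj => hS (fun h => hi (h ▸ hj))
    have h := ProbabilityTheory.indep_iSup_of_disjoint
      (fun e => (measurable_pi_apply e).comap_le) hind hdisj
    exact ((ProbabilityTheory.Indep_iff _ _ _).1 h) _ _ (hU i) (hmeas s)

/-- The event that a conduit with entries `a` and exits `b` exists in the box
`]0, n] ^ D × ]0, m]`, for the discretized capacities. -/
def conduitEvent (κ : ℝ≥0) (n m : ℕ) (a b : (Fin D → ℤ) → ℝ) : Set (Edge D → ℝ≥0) :=
  {t | ∃ f, IsConduit (discretize κ t) (fun _ => n) m a b f}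

/-- The discretized capacities of the box take countably many values, hence no closedness argument
is needed for the measurability of the event. -/
theorem measurableSet_conduitEvent_comp (κ : ℝ≥0) (n m : ℕ) (a b : (Fin D → ℤ) → ℝ)
    (σ : Edge D → Edge D) :
    MeasurableSet[edgeAlgebra (σ '' (innerEdges (fun _ : Fin D => n) m : Set (Edge D)))]
      {t : Edge D → ℝ≥0 | (fun e => t (σ e)) ∈ conduitEvent κ n m a b} := by
  let G : (Edge D → ℝ≥0) → (↥(innerEdges (fun _ : Fin D => n) m) → ℕ) :=
    fun t e => ⌊κ * t (σ e)⌋₊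
  have hG :
      Measurable[edgeAlgebra (σ '' (innerEdges (fun _ : Fin D => n) m : Set (Edge D)))] G := by
    refine @measurable_pi_lambda _ _ _ (edgeAlgebra _) _ G fun e => ?_
    have h1 : Measurable[edgeAlgebra (σ '' (innerEdges (fun _ : Fin D => n) m : Set (Edge D)))]
        (fun t : Edge D → ℝ≥0 => t (σ e)) :=
      measurable_edgeAlgebra (Set.mem_image_of_mem σ e.2)
    exact Nat.measurable_floor.comp ((measurable_const_mul κ).comp h1)
  have hpre : {t : Edge D → ℝ≥0 | (fun e => t (σ e)) ∈ conduitEvent κ n m a b} =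
      G ⁻¹' (G '' {t | (fun e => t (σ e)) ∈ conduitEvent κ n m a b}) := by
    refine subset_antisymm (Set.subset_preimage_image _ _) ?_
    rintro t ⟨t', ⟨f, hf⟩, hGt⟩
    refine ⟨f, hf.mono fun e he => le_of_eq ?_⟩
    have := congrFun hGt ⟨e, he⟩
    simp only [G] at this
    simp only [discretize, this]
  rw [hpre]
  exact hG (Set.to_countable _).measurableSet

theorem measurableSet_conduitEvent (κ : ℝ≥0) (n m : ℕ) (a b : (Fin D → ℤ) → ℝ) :
    MeasurableSet (conduitEvent κ n m a b) :=
  edgeAlgebra_le _ _ (measurableSet_conduitEvent_comp κ n m a b id)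

theorem measure_conduitEvent_comp (F : Measure ℝ≥0) [IsProbabilityMeasure F] (κ : ℝ≥0) (n m : ℕ)
    (a b : (Fin D → ℤ) → ℝ) {σ : Edge D → Edge D} (hσ : Function.Injective σ) :
    capacityLaw D F {t | (fun e => t (σ e)) ∈ conduitEvent κ n m a b} =
      capacityLaw D F (conduitEvent κ n m a b) := by
  have h := Measure.map_infinitePi_infinitePi_of_inj (P := fun _ : Edge D => F) hσ
  conv_rhs => rw [capacityLaw, ← h]
  rw [Measure.map_apply (by fun_prop) (measurableSet_conduitEvent κ n m a b)]
  rfl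

theorem measure_conduitEvent_symm (F : Measure ℝ≥0) [IsProbabilityMeasure F] (κ : ℝ≥0) (n m : ℕ)
    (a b : (Fin D → ℤ) → ℝ) :
    capacityLaw D F (conduitEvent κ n m a b) = capacityLaw D F (conduitEvent κ n m b a) := by
  have key : ∀ a b : (Fin D → ℤ) → ℝ,
      capacityLaw D F (conduitEvent κ n m a b) ≤ capacityLaw D F (conduitEvent κ n m b a) := by
    intro a b
    rw [← measure_conduitEvent_comp F κ n m b a (reflectEdge_involutive m).injective]
    refine measure_mono ?_
    rintro t ⟨f, hf⟩
    exact hf.reflect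
  exact le_antisymm (key a b) (key b a)

/-- The vertical edges above the fringe. -/
noncomputable def fringeEdges (D n r H : ℕ) : Finset (Edge D) :=
  (fringe D n r ×ˢ Finset.Ico (0 : ℤ) H).image
    fun p => (Fin.snoc (α := fun _ => ℤ) p.1 p.2, Fin.last D)

theorem mem_fringeEdges {n r H : ℕ} {e : Edge D} : e ∈ fringeEdges D n r H ↔
    e.2 = Fin.last D ∧ base e.1 ∈ fringe D n r ∧ 0 ≤ height e.1 ∧ height e.1 < H := by
  simp only [fringeEdges, Finset.mem_image, Finset.mem_product, Finset.mem_Ico]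
  constructor
  · rintro ⟨⟨x, z⟩, ⟨h1, h2, h3⟩, rfl⟩
    exact ⟨rfl, by rwa [base_snoc], by rwa [height_snoc], by rwa [height_snoc]⟩
  · rintro ⟨h1, h2, h3, h4⟩
    exact ⟨(base e.1, height e.1), ⟨h2, h3, h4⟩, Prod.ext (snoc_base_height e.1) h1.symm⟩

theorem card_fringeEdges_le {n r H : ℕ} (h : r ≤ n) :
    (fringeEdges D n r H).card ≤ (n ^ D - r ^ D) * H := by
  refine Finset.card_image_le.trans (le_of_eq ?_)
  rw [Finset.card_product, card_fringe h, Int.card_Ico]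
  simp

/-- Lower bound for the probability of a large flow in a large box: it is enough to have conduits
with entries `a` and exits `b`, or the other way round, in all the cells of a tiling, and large
capacities above the fringe. -/
theorem pow_mul_pow_le_upperProb (F : Measure ℝ≥0) [IsProbabilityMeasure F] {κ κ' : ℝ≥0}
    (hκ : ∀ (t : Edge D → ℝ≥0) e, discretize κ t e ≤ discretize κ' t e) {N M q K n H : ℕ}
    (hq : q * N ≤ n) (hH : 1 ≤ H) (hHK : H ≤ M * K) {a b : (Fin D → ℤ) → ℝ} {l l' : ℝ≥0}
    (ha : ∀ x, x ∉ crossSection (fun _ => N) → a x = 0)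
    (hal : (l : ℝ) * (N : ℝ) ^ D ≤ ∑ x ∈ crossSection (fun _ => N), a x)
    (hl : ∀ s : ℝ≥0, l' ≤ s → l ≤ (⌊κ' * s⌋₊ : ℝ≥0) / κ') :
    capacityLaw D F (conduitEvent κ N M a b) ^ (q ^ D * K) *
      F (Set.Ici l') ^ ((n ^ D - (q * N) ^ D) * (M * K)) ≤ upperProb D F κ' n H l := by
  classical
  let c : ℕ → (Fin D → ℤ) → ℝ := fun k => if Even k then a else b
  let σ : Cell D q K → Edge D → Edge D := fun j =>
    translateEdge (cellOffset N M (fun i => j.1 i) j.2)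
  have hσ : ∀ j, Function.Injective (σ j) := fun j =>
    Function.LeftInverse.injective (translateEdge_neg_left _)
  let S : Cell D q K ⊕ ↥(fringeEdges D n (q * N) (M * K)) → Set (Edge D) :=
    Sum.elim (fun j => σ j '' (innerEdges (fun _ : Fin D => N) M : Set (Edge D))) (fun e => {e.1})
  let U : Cell D q K ⊕ ↥(fringeEdges D n (q * N) (M * K)) → Set (Edge D → ℝ≥0) :=
    Sum.elim (fun j => {t | (fun e => t (σ j e)) ∈ conduitEvent κ N M (c j.2) (c (j.2 + 1))})
      (fun e => {t | l' ≤ t e})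
  have hcell : ∀ j e, e ∈ σ j '' (innerEdges (fun _ : Fin D => N) M : Set (Edge D)) →
      InCell N M (fun i => j.1 i) j.2 e := by
    rintro j _ ⟨e, he, rfl⟩
    rw [InCell, translateEdge_neg_left]
    exact he
  have hcf : ∀ j e, e ∈ σ j '' (innerEdges (fun _ : Fin D => N) M : Set (Edge D)) →
      e ∉ fringeEdges D n (q * N) (M * K) := fun j e he hf =>
    (Finset.mem_sdiff.1 (mem_fringeEdges.1 hf).2.1).2
      (column_subset (fun i => (j.1 i).2) (inCell_iff.1 (hcell j e he)).1)
  have hS : Pairwise fun i j => Disjoint (S i) (S j) := by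
    rintro (j | e) (j' | e') hne
    · rw [Set.disjoint_left]
      intro e he he'
      have := (hcell j e he).unique (hcell j' e he')
      refine hne (congrArg _ (Prod.ext (funext fun i => ?_) ?_))
      · exact Fin.ext (congrFun this.1 i)
      · exact Fin.ext this.2
    · exact Set.disjoint_singleton_right.2 fun h => hcf j _ h e'.2
    · exact Set.disjoint_singleton_left.2 fun h => hcf j' _ h e.2
    · exact Set.disjoint_singleton.2 fun h => hne (congrArg _ (Subtype.ext h))
  have hU : ∀ i, MeasurableSet[edgeAlgebra (S i)] (U i) := by
    rintro (j | e)
    · exact measurableSet_conduitEvent_comp κ N M _ _ (σ j)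
    · exact measurable_edgeAlgebra (Set.mem_singleton e.1) measurableSet_Ici
  have hprobl : ∀ j, capacityLaw D F (U (Sum.inl j)) =
      capacityLaw D F (conduitEvent κ N M a b) := by
    intro j
    change capacityLaw D F {t | (fun e => t (σ j e)) ∈ conduitEvent κ N M _ _} = _
    rw [measure_conduitEvent_comp F κ N M _ _ (hσ j)]
    by_cases h : Even (j.2 : ℕ)
    · simp [c, h, Nat.even_add_one]
    · simp only [c, h, Nat.even_add_one, if_false, if_true, not_false_eq_true]
      exact measure_conduitEvent_symm F κ N M b a
  have hprobr : ∀ e, capacityLaw D F (U (Sum.inr e)) = F (Set.Ici l') := by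
    intro e
    exact (measurePreserving_eval_infinitePi (fun _ : Edge D => F) e.1).measure_preimage
      measurableSet_Ici.nullMeasurableSet
  have hinter := measure_biInter_eq_prod F hS hU Finset.univ
  rw [Fintype.prod_sum_type] at hinter
  simp only [hprobl, hprobr, Finset.prod_const, Finset.card_univ, Fintype.card_prod,
    Fintype.card_fun, Fintype.card_fin, Fintype.card_coe] at hinter
  calc _ ≤ capacityLaw D F (conduitEvent κ N M a b) ^ (q ^ D * K) *
        F (Set.Ici l') ^ (fringeEdges D n (q * N) (M * K)).card := by
        exact mul_le_mul' le_rfl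
          (pow_le_pow_right_of_le_one' prob_le_one (card_fringeEdges_le hq))
    _ = capacityLaw D F (⋂ i ∈ Finset.univ, U i) := hinter.symm
    _ ≤ _ := by
        refine measure_mono fun t ht => ?_
        simp only [Finset.mem_univ, Set.iInter_true, Set.mem_iInter] at ht
        have h1 : ∀ j : Cell D q K, ∃ f, IsConduit
            (fun e => discretize κ' t (translateEdge (cellOffset N M (fun i => j.1 i) j.2) e))
            (fun _ => N) M (c j.2) (c (j.2 + 1)) f := by
          intro j
          obtain ⟨f, hf⟩ := ht (Sum.inl j)
          exact ⟨f, hf.mono fun e _ => hκ t _⟩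
        obtain ⟨b', f, hf⟩ := exists_conduit_glue (t := discretize κ' t) (l := l) hq h1
          fun e h2 h3 h4 h5 => hl _ (ht (Sum.inr ⟨e, mem_fringeEdges.2 ⟨h2, h3, h4, h5⟩⟩))
        have h2 := hf.sum_le_maxFlow hH hHK
        have hc : c 0 = a := by simp [c]
        rw [hc, sum_glued_entries hq ha] at h2
        refine le_trans ?_ h2
        have h3 : (q : ℝ) ^ D * (l * (N : ℝ) ^ D) ≤
            (q : ℝ) ^ D * ∑ x ∈ crossSection (fun _ => N), a x := by gcongr
        rw [mul_pow]
        linarith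

/-- Upper bound for the probability of a large flow: a union bound over the boundary conditions. -/
theorem exists_upperProb_le (F : Measure ℝ≥0) [IsProbabilityMeasure F] {κ : ℝ≥0} (hκ : 0 < κ)
    {n m : ℕ} (hm : 1 ≤ m) (l : ℝ≥0) (hpos : upperProb D F κ n m l ≠ 0) :
    ∃ a b : (Fin D → ℤ) → ℝ, (∀ x, x ∉ crossSection (fun _ => n) → a x = 0) ∧
      (l : ℝ) * (n : ℝ) ^ D ≤ ∑ x ∈ crossSection (fun _ => n), a x ∧
      upperProb D F κ n m l ≤
        ((4 * (D + 1) * ⌈κ * l * n ^ D⌉₊ + 1) ^ (2 * n ^ D) : ℕ) *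
          capacityLaw D F (conduitEvent κ n m a b) := by
  classical
  set R : ℕ := ⌈κ * l * n ^ D⌉₊ with hR
  let B : ℤ := 2 * (D + 1) * R
  let C : Type := ↥(crossSection (fun _ : Fin D => n)) → ↥(Finset.Icc (-B) B)
  let ext : C → (Fin D → ℤ) → ℤ := fun α x =>
    if h : x ∈ crossSection (fun _ : Fin D => n) then (α ⟨x, h⟩ : ℤ) else 0
  have hext : ∀ α : (Fin D → ℤ) → ℤ, (∀ x, |α x| ≤ B) →
      (∀ x, x ∉ crossSection (fun _ : Fin D => n) → α x = 0) → ∃ α' : C, ext α' = α := by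
    intro α h1 h2
    refine ⟨fun x => ⟨α x, Finset.mem_Icc.2 (abs_le.1 (h1 x))⟩, funext fun x => ?_⟩
    simp only [ext]
    split_ifs with h
    · rfl
    · exact (h2 x h).symm
  have hκ' : (0 : ℝ) < κ := hκ
  let I : Finset (C × C) :=
    Finset.univ.filter fun p => (R : ℤ) ≤ ∑ x ∈ crossSection (fun _ : Fin D => n), ext p.1 x
  let E : C × C → Set (Edge D → ℝ≥0) := fun p =>
    conduitEvent κ n m (fun x => ext p.1 x / κ) (fun x => ext p.2 x / κ)
  have hcover : {t | (l : ℝ) * (n : ℝ) ^ D ≤ maxFlow (discretize κ t) (fun _ => n) m} ⊆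
      ⋃ p ∈ I, E p := by
    intro t ht
    have hRlt : (R : ℝ) - 1 < κ * (l * (n : ℝ) ^ D) := by
      have h1 := Nat.ceil_lt_add_one (a := κ * l * n ^ D) zero_le
      rw [← hR] at h1
      have h2 : (R : ℝ) < κ * l * n ^ D + 1 := by exact_mod_cast h1
      linarith
    obtain ⟨α, β, h1, h2, h3, h4, h5, h6⟩ := exists_conduit_of_le_maxFlow hm hκ ht hRlt
    obtain ⟨α', rfl⟩ := hext α h1 h3
    obtain ⟨β', rfl⟩ := hext β h2 h4
    refine Set.mem_biUnion (x := (α', β')) ?_ h6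
    exact Finset.mem_filter.2 ⟨Finset.mem_univ _, h5⟩
  have hbound : upperProb D F κ n m l ≤ ∑ p ∈ I, capacityLaw D F (E p) :=
    (measure_mono hcover).trans (measure_biUnion_finset_le I E)
  have hI : I.Nonempty := by
    rw [Finset.nonempty_iff_ne_empty]
    intro h
    rw [h, Finset.sum_empty] at hbound
    exact hpos (le_antisymm hbound zero_le)
  obtain ⟨p, hp, hmax⟩ := I.exists_max_image (fun p => capacityLaw D F (E p)) hI
  refine ⟨fun x => ext p.1 x / κ, fun x => ext p.2 x / κ, ?_, ?_, ?_⟩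
  · intro x hx
    simp [ext, hx]
  · have h1 := (Finset.mem_filter.1 hp).2
    have h2 : κ * l * n ^ D ≤ (R : ℝ≥0) := Nat.le_ceil _
    have h2' : (κ : ℝ) * l * n ^ D ≤ (R : ℝ) := by exact_mod_cast h2
    have h3 : (R : ℝ) ≤ ∑ x ∈ crossSection (fun _ : Fin D => n), (ext p.1 x : ℝ) := by
      exact_mod_cast h1
    rw [← Finset.sum_div, le_div_iff₀ hκ']
    linarith
  · refine hbound.trans ((Finset.sum_le_card_nsmul _ _ _ hmax).trans ?_)
    rw [nsmul_eq_mul]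
    gcongr
    refine (Finset.card_filter_le _ _).trans (le_of_eq ?_)
    have h1 : Fintype.card C = (4 * (D + 1) * R + 1) ^ n ^ D := by
      simp only [C, Fintype.card_fun, Fintype.card_coe, Int.card_Icc, card_crossSection]
      congr 1
      have hB : (0 : ℤ) ≤ B := by positivity
      zify
      rw [Int.toNat_of_nonneg (by linarith)]
      simp only [B]
      ring
    rw [Finset.card_univ, Fintype.card_prod, h1]
    ring

/-! ### The rescaled logarithm -/

theorem rate_le_of_ofReal_le (F : Measure ℝ≥0) [IsProbabilityMeasure F] {κ : ℝ≥0} {n m : ℕ}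
    {l : ℝ≥0} {x : ℝ} (hx : 0 < x) (h : ENNReal.ofReal x ≤ upperProb D F κ n m l) :
    rate D F κ n m l ≤ ((-Real.log x / ((n : ℝ) ^ D * m) : ℝ) : EReal) := by
  have h1 : ((Real.log x : ℝ) : EReal) ≤ ENNReal.log (upperProb D F κ n m l) := by
    rw [← ENNReal.log_ofReal_of_pos hx]
    exact ENNReal.log_monotone h
  have h2 : (0 : EReal) ≤ ((1 / ((n : ℝ) ^ D * (m : ℝ)) : ℝ) : EReal) :=
    EReal.coe_nonneg.2 (by positivity)
  have h3 := mul_le_mul_of_nonneg_left h1 h2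
  rw [← EReal.coe_mul] at h3
  refine (EReal.neg_le_neg_iff.2 h3).trans (le_of_eq ?_)
  rw [← EReal.coe_neg]
  congr 1
  ring

theorem rate_eq_of_ne_zero (F : Measure ℝ≥0) [IsProbabilityMeasure F] {κ : ℝ≥0} {n m : ℕ}
    {l : ℝ≥0} (h : upperProb D F κ n m l ≠ 0) :
    rate D F κ n m l =
      ((-Real.log (upperProb D F κ n m l).toReal / ((n : ℝ) ^ D * m) : ℝ) : EReal) := by
  rw [rate, ENNReal.log_pos_real h (measure_ne_top _ _), ← EReal.coe_mul, ← EReal.coe_neg]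
  congr 1
  ring

theorem rate_eq_top_of_eq_zero (F : Measure ℝ≥0) [IsProbabilityMeasure F] {κ : ℝ≥0} {n m : ℕ}
    {l : ℝ≥0} (hn : 1 ≤ n) (hm : 1 ≤ m) (h : upperProb D F κ n m l = 0) :
    rate D F κ n m l = ⊤ := by
  rw [rate, h, ENNReal.log_zero, EReal.coe_mul_bot_of_pos, EReal.neg_bot]
  have h1 : (0 : ℝ) < n := by exact_mod_cast hn
  have h2 : (0 : ℝ) < m := by exact_mod_cast hm
  positivity

theorem discretize_mono {χ χ' : ℤ} (h : χ ≤ χ') (t : Edge D → ℝ≥0) (e : Edge D) :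
    discretize ((2 : ℝ≥0) ^ χ) t e ≤ discretize ((2 : ℝ≥0) ^ χ') t e := by
  obtain ⟨j, hj⟩ := Int.le.dest h
  have h1 : (2 : ℝ≥0) ^ χ' = (2 : ℝ≥0) ^ χ * ((2 ^ j : ℕ) : ℝ≥0) := by
    rw [← hj, zpow_add₀ two_ne_zero, zpow_natCast, Nat.cast_pow, Nat.cast_ofNat]
  have h2 : (0 : ℝ≥0) < (2 : ℝ≥0) ^ χ := by positivity
  have h3 : (0 : ℝ≥0) < ((2 ^ j : ℕ) : ℝ≥0) := by positivity
  simp only [discretize]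
  rw [h1, div_le_div_iff₀ h2 (mul_pos h2 h3)]
  have h4 : ⌊(2 : ℝ≥0) ^ χ * t e⌋₊ * 2 ^ j ≤ ⌊(2 : ℝ≥0) ^ χ * ((2 ^ j : ℕ) : ℝ≥0) * t e⌋₊ := by
    refine Nat.le_floor ?_
    push_cast
    rw [mul_right_comm]
    gcongr
    exact Nat.floor_le zero_le
  have h5 : ((⌊(2 : ℝ≥0) ^ χ * t e⌋₊ : ℝ≥0)) * ((2 ^ j : ℕ) : ℝ≥0) ≤
      (⌊(2 : ℝ≥0) ^ χ * ((2 ^ j : ℕ) : ℝ≥0) * t e⌋₊ : ℝ≥0) := by exact_mod_cast h4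
  calc _ = (2 : ℝ≥0) ^ χ * ((⌊(2 : ℝ≥0) ^ χ * t e⌋₊ : ℝ≥0) * ((2 ^ j : ℕ) : ℝ≥0)) := by ring
    _ ≤ (2 : ℝ≥0) ^ χ * _ := by gcongr
    _ = _ := mul_comm _ _

/-- The lower bound on probabilities in terms of rates: `Λ` is the cost of a conduit in a cell, and
`Γ` that of a large capacity above the fringe. -/
theorem rate_le_of_tiling (F : Measure ℝ≥0) [IsProbabilityMeasure F] {κ κ' : ℝ≥0}
    (hκ : ∀ (t : Edge D → ℝ≥0) e, discretize κ t e ≤ discretize κ' t e) {N M n H : ℕ}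
    (hN : 1 ≤ N) (hM : 1 ≤ M) (hn : N ≤ n) (hH : 1 ≤ H) {a b : (Fin D → ℤ) → ℝ} {l l' : ℝ≥0}
    (ha : ∀ x, x ∉ crossSection (fun _ => N) → a x = 0)
    (hal : (l : ℝ) * (N : ℝ) ^ D ≤ ∑ x ∈ crossSection (fun _ => N), a x)
    (hl : ∀ s : ℝ≥0, l' ≤ s → l ≤ (⌊κ' * s⌋₊ : ℝ≥0) / κ')
    (hp : capacityLaw D F (conduitEvent κ N M a b) ≠ 0) (hc : F (Set.Ici l') ≠ 0) :
    rate D F κ' n H l ≤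
      ((1 / (N : ℝ) ^ D * (1 / M + 1 / H) *
          -Real.log (capacityLaw D F (conduitEvent κ N M a b)).toReal +
        (1 - (1 - (N : ℝ) / n) ^ D) * (1 + M / H) * -Real.log (F (Set.Ici l')).toReal : ℝ) :
          EReal) := by
  have hq : n / N * N ≤ n := Nat.div_mul_le_self n N
  have hHK : H ≤ M * (H / M + 1) := (Nat.lt_mul_div_succ H hM).le
  have hprob := pow_mul_pow_le_upperProb F hκ hq hH hHK ha hal hl (b := b)
  set p := (capacityLaw D F (conduitEvent κ N M a b)).toReal with hpdef
  set c := (F (Set.Ici l')).toReal with hcdef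
  have hp0 : 0 < p := ENNReal.toReal_pos hp (measure_ne_top _ _)
  have hc0 : 0 < c := ENNReal.toReal_pos hc (measure_ne_top _ _)
  have hΛ : 0 ≤ -Real.log p := neg_nonneg.2 (Real.log_nonpos hp0.le
    (ENNReal.toReal_le_of_le_ofReal zero_le_one (by simpa using prob_le_one)))
  have hΓ : 0 ≤ -Real.log c := neg_nonneg.2 (Real.log_nonpos hc0.le
    (ENNReal.toReal_le_of_le_ofReal zero_le_one (by simpa using prob_le_one)))
  set e1 := (n / N) ^ D * (H / M + 1) with he1
  set e2 := (n ^ D - (n / N * N) ^ D) * (M * (H / M + 1)) with he2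
  have hx : ENNReal.ofReal (p ^ e1 * c ^ e2) ≤ upperProb D F κ' n H l := by
    refine le_trans (le_of_eq ?_) hprob
    rw [ENNReal.ofReal_mul (by positivity), ENNReal.ofReal_pow hp0.le, ENNReal.ofReal_pow hc0.le,
      hpdef, hcdef, ENNReal.ofReal_toReal (measure_ne_top _ _),
      ENNReal.ofReal_toReal (measure_ne_top _ _)]
  refine (rate_le_of_ofReal_le F (by positivity) hx).trans (EReal.coe_le_coe_iff.2 ?_)
  have hN' : (0 : ℝ) < N := by exact_mod_cast hN
  have hM' : (0 : ℝ) < M := by exact_mod_cast hM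
  have hn' : (0 : ℝ) < n := by exact_mod_cast hN.trans hn
  have hH' : (0 : ℝ) < H := by exact_mod_cast hH
  have hnN : (0 : ℝ) ≤ n - N := sub_nonneg.2 (by exact_mod_cast hn)
  rw [Real.log_mul (by positivity) (by positivity), Real.log_pow, Real.log_pow]
  have hK : ((H / M + 1 : ℕ) : ℝ) ≤ H / M + 1 := by
    push_cast
    gcongr
    exact Nat.cast_div_le
  have hq1 : ((n / N : ℕ) : ℝ) ≤ n / N := Nat.cast_div_le
  have hq2 : (n : ℝ) - N ≤ ((n / N * N : ℕ) : ℝ) := by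
    have h1 := Nat.div_add_mod n N
    have h2 := Nat.mod_lt n hN
    have h3 : n ≤ n / N * N + N := by rw [mul_comm]; omega
    rw [sub_le_iff_le_add]
    exact_mod_cast h3
  have hE1 : (e1 : ℝ) ≤ (n / N : ℝ) ^ D * (H / M + 1) := by
    rw [he1]
    push_cast at hK ⊢
    gcongr
  have hE2 : (e2 : ℝ) ≤ ((n : ℝ) ^ D - (n - N) ^ D) * (M * (H / M + 1)) := by
    rw [he2, Nat.cast_mul, Nat.cast_sub (Nat.pow_le_pow_left hq D), Nat.cast_mul]
    have h4 : ((n : ℝ) - N) ^ D ≤ (n : ℝ) ^ D := by gcongr; linarith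
    have h5 : ((n : ℝ) - N) ^ D ≤ ((n / N * N : ℕ) : ℝ) ^ D := by gcongr
    rw [Nat.cast_pow, Nat.cast_pow]
    gcongr
  have hfinal : -((e1 : ℝ) * Real.log p + e2 * Real.log c) ≤
      (n / N : ℝ) ^ D * (H / M + 1) * -Real.log p +
        ((n : ℝ) ^ D - (n - N) ^ D) * (M * (H / M + 1)) * -Real.log c := by
    have h6 := mul_le_mul_of_nonneg_right hE1 hΛ
    have h7 := mul_le_mul_of_nonneg_right hE2 hΓ
    linarith
  rw [div_le_iff₀ (by positivity)]
  refine hfinal.trans (le_of_eq ?_)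
  have h8 : (1 - (N : ℝ) / n) ^ D * (n : ℝ) ^ D = (n - N) ^ D := by
    rw [← mul_pow]
    congr 1
    field_simp
  have h9 : (1 - (1 - (N : ℝ) / n) ^ D) * (n : ℝ) ^ D = (n : ℝ) ^ D - (n - N) ^ D := by
    rw [sub_mul, one_mul, h8]
  rw [← h9, div_pow]
  field_simp

/-! ### Comparison of the rates of two admissible pairs -/

theorem Admissible.tendsto_exponent_real {h : ℕ → ℕ} {χ : ℕ → ℤ} (hA : Admissible h χ) :
    Tendsto (fun n => (χ n : ℝ)) atTop atTop :=
  tendsto_intCast_atTop_atTop.comp hA.exponent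

/-- If `l < μ`, then with positive probability the capacity of an edge is still at least `l` after
discretization at any fine enough scale. -/
theorem exists_level {F : Measure ℝ≥0} {l : ℝ≥0} (hl : (l : ℝ≥0∞) < supSupport F)
    [IsProbabilityMeasure F] {h : ℕ → ℕ} {χ : ℕ → ℤ} (hA : Admissible h χ) :
    ∃ l' : ℝ≥0, F (Set.Ici l') ≠ 0 ∧
      ∀ᶠ n in atTop, ∀ s : ℝ≥0, l' ≤ s →
        l ≤ (⌊(2 : ℝ≥0) ^ χ n * s⌋₊ : ℝ≥0) / (2 : ℝ≥0) ^ χ n := by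
  rw [supSupport, lt_iSup_iff] at hl
  obtain ⟨l', hl'⟩ := hl
  rw [lt_iSup_iff] at hl'
  obtain ⟨hF, hll'⟩ := hl'
  rw [ENNReal.coe_lt_coe] at hll'
  refine ⟨l', fun h0 => ?_, ?_⟩
  · have h1 : F (Set.Iio l') = 1 := by
      rw [← prob_compl_eq_zero_iff measurableSet_Iio, Set.compl_Iio, h0]
    exact hF.ne h1
  · have hpow : Tendsto (fun n => (2 : ℝ) ^ (χ n : ℝ)) atTop atTop :=
      (tendsto_rpow_atTop_of_base_gt_one 2 one_lt_two).comp hA.tendsto_exponent_real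
    have hpos : (0 : ℝ) < l' - l := sub_pos.2 (by exact_mod_cast hll')
    filter_upwards [hpow.eventually_ge_atTop (1 / ((l' : ℝ) - l))] with n hn s hs
    rw [Real.rpow_intCast] at hn
    have h2 : (0 : ℝ) < (2 : ℝ) ^ χ n := by positivity
    rw [le_div_iff₀ (by positivity), ← NNReal.coe_le_coe]
    push_cast
    have h3 : (2 : ℝ) ^ χ n * s - 1 < (⌊(2 : ℝ≥0) ^ χ n * s⌋₊ : ℝ) := by
      have := Nat.lt_floor_add_one ((2 : ℝ≥0) ^ χ n * s)
      rw [← NNReal.coe_lt_coe] at this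
      push_cast at this
      linarith
    rw [div_le_iff₀ hpos] at hn
    have hs' : (l' : ℝ) ≤ s := by exact_mod_cast hs
    have h4 := mul_le_mul_of_nonneg_left hs' h2.le
    nlinarith

/-- The logarithm of the number of boundary conditions is negligible: this is where the
condition on the ratio in the definition of an admissible pair is used. -/
theorem tendsto_log_card_div (D : ℕ) (l : ℝ≥0) {h : ℕ → ℕ} {χ : ℕ → ℤ} (hA : Admissible h χ) :
    Tendsto (fun n => Real.log
      (((4 * (D + 1) * ⌈(2 : ℝ≥0) ^ χ n * l * n ^ D⌉₊ + 1) ^ (2 * n ^ D) : ℕ) : ℝ) /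
        ((n : ℝ) ^ D * h n)) atTop (𝓝 0) := by
  set A : ℝ := 4 * (D + 1) * (l + 1) + 1 with hAdef
  have hA1 : 1 ≤ A := by
    have : (0 : ℝ) ≤ 4 * (D + 1) * (l + 1) := by positivity
    linarith
  have hlogA : 0 ≤ Real.log A := Real.log_nonneg hA1
  have hlim := hA.ratio.const_mul (2 * (Real.log A + 1 + D))
  rw [mul_zero] at hlim
  refine squeeze_zero' (Eventually.of_forall fun n => div_nonneg
    (Real.log_natCast_nonneg _) (by positivity)) ?_ hlim
  filter_upwards [eventually_ge_atTop 3, hA.exponent.eventually_ge_atTop 1] with n hn hχ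
  have hn' : (0 : ℝ) < n := by positivity
  have hκ1 : (1 : ℝ) ≤ (2 : ℝ) ^ χ n := one_le_zpow₀ one_le_two (by omega)
  have hn1 : (1 : ℝ) ≤ (n : ℝ) ^ D := one_le_pow₀ (by exact_mod_cast (by omega : 1 ≤ n))
  have hX : (1 : ℝ) ≤ (2 : ℝ) ^ χ n * n ^ D := one_le_mul_of_one_le_of_one_le hκ1 hn1
  have hR : (⌈(2 : ℝ≥0) ^ χ n * l * n ^ D⌉₊ : ℝ) ≤ (l + 1) * ((2 : ℝ) ^ χ n * n ^ D) := by
    have h1 := Nat.ceil_lt_add_one (a := (2 : ℝ≥0) ^ χ n * l * n ^ D) zero_le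
    rw [← NNReal.coe_lt_coe] at h1
    push_cast at h1
    nlinarith
  have hlogn : 1 ≤ Real.log n := by
    rw [Real.le_log_iff_exp_le hn']
    have h2 : (3 : ℝ) ≤ n := by exact_mod_cast hn
    exact Real.exp_one_lt_three.le.trans h2
  have hχ' : (1 : ℝ) ≤ χ n := by exact_mod_cast hχ
  have hlog : Real.log ((4 * (D + 1) * ⌈(2 : ℝ≥0) ^ χ n * l * n ^ D⌉₊ + 1 : ℕ) : ℝ) ≤
      (Real.log A + 1 + D) * (χ n * Real.log n) := by
    have h3 : ((4 * (D + 1) * ⌈(2 : ℝ≥0) ^ χ n * l * n ^ D⌉₊ + 1 : ℕ) : ℝ) ≤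
        A * ((2 : ℝ) ^ χ n * n ^ D) := by
      push_cast
      rw [hAdef]
      have := mul_le_mul_of_nonneg_left hR (show (0 : ℝ) ≤ 4 * (D + 1) by positivity)
      nlinarith
    have h4 := Real.log_le_log (by positivity) h3
    rw [Real.log_mul (by positivity) (by positivity), Real.log_mul (by positivity) (by positivity),
      Real.log_zpow, Real.log_pow] at h4
    refine h4.trans ?_
    have h5 : 1 ≤ χ n * Real.log n := one_le_mul_of_one_le_of_one_le hχ' hlogn
    have h6 : χ n * Real.log 2 ≤ χ n * Real.log n := by
      gcongr
      exact_mod_cast (by omega : 2 ≤ n)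
    have h7 : Real.log n ≤ χ n * Real.log n := le_mul_of_one_le_left (by linarith) hχ'
    have h8 : Real.log A ≤ Real.log A * (χ n * Real.log n) := le_mul_of_one_le_right hlogA h5
    have h9 : (D : ℝ) * Real.log n ≤ D * (χ n * Real.log n) := by gcongr
    linarith
  rw [Nat.cast_pow, Real.log_pow, Nat.cast_mul, Nat.cast_pow, Nat.cast_ofNat]
  rw [show 2 * (n : ℝ) ^ D * Real.log ((4 * (D + 1) * ⌈(2 : ℝ≥0) ^ χ n * l * n ^ D⌉₊ + 1 : ℕ) : ℝ) /
      ((n : ℝ) ^ D * h n) =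
      2 * Real.log ((4 * (D + 1) * ⌈(2 : ℝ≥0) ^ χ n * l * n ^ D⌉₊ + 1 : ℕ) : ℝ) / h n by
    rw [show 2 * (n : ℝ) ^ D *
        Real.log ((4 * (D + 1) * ⌈(2 : ℝ≥0) ^ χ n * l * n ^ D⌉₊ + 1 : ℕ) : ℝ) = (n : ℝ) ^ D *
        (2 * Real.log ((4 * (D + 1) * ⌈(2 : ℝ≥0) ^ χ n * l * n ^ D⌉₊ + 1 : ℕ) : ℝ)) by ring,
      mul_div_mul_left _ _ (by positivity)]]
  rw [← mul_div_assoc]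
  refine div_le_div_of_nonneg_right ?_ (Nat.cast_nonneg _)
  linarith

/-- The rate in one box bounds, up to the entropy of the boundary conditions, the rates of an
arbitrary admissible pair in all large boxes. -/
theorem eventually_rate_le (F : Measure ℝ≥0) [IsProbabilityMeasure F] {l : ℝ≥0}
    (hl : (l : ℝ≥0∞) < supSupport F) {h : ℕ → ℕ} {χ : ℕ → ℤ} (hA : Admissible h χ) {χ₀ : ℤ}
    {N M : ℕ} (hN : 1 ≤ N) (hM : 1 ≤ M) (hpos : upperProb D F ((2 : ℝ≥0) ^ χ₀) N M l ≠ 0)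
    {ε : ℝ} (hε : 0 < ε) :
    ∀ᶠ n in atTop, rate D F ((2 : ℝ≥0) ^ χ n) n (h n) l ≤
      ((-Real.log (upperProb D F ((2 : ℝ≥0) ^ χ₀) N M l).toReal / ((N : ℝ) ^ D * M) +
        Real.log (((4 * (D + 1) * ⌈(2 : ℝ≥0) ^ χ₀ * l * N ^ D⌉₊ + 1) ^ (2 * N ^ D) : ℕ) : ℝ) /
        ((N : ℝ) ^ D * M) + ε : ℝ) : EReal) := by
  obtain ⟨l', hc, hlev⟩ := exists_level hl hA
  obtain ⟨a, b, ha, hal, hup⟩ := exists_upperProb_le F (by positivity) hM l hpos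
  set Q : ℕ := (4 * (D + 1) * ⌈(2 : ℝ≥0) ^ χ₀ * l * N ^ D⌉₊ + 1) ^ (2 * N ^ D) with hQdef
  have hQ : (0 : ℝ) < Q := by
    have : 0 < Q := by positivity
    exact_mod_cast this
  have hp : capacityLaw D F (conduitEvent ((2 : ℝ≥0) ^ χ₀) N M a b) ≠ 0 := by
    intro h0
    rw [h0, mul_zero] at hup
    exact hpos (le_antisymm hup zero_le)
  have hN' : (0 : ℝ) < N := by exact_mod_cast hN
  have hM' : (0 : ℝ) < M := by exact_mod_cast hM
  set p := (capacityLaw D F (conduitEvent ((2 : ℝ≥0) ^ χ₀) N M a b)).toReal with hpdef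
  set P := (upperProb D F ((2 : ℝ≥0) ^ χ₀) N M l).toReal with hPdef
  have hp0 : 0 < p := ENNReal.toReal_pos hp (measure_ne_top _ _)
  have hP0 : 0 < P := ENNReal.toReal_pos hpos (measure_ne_top _ _)
  have hlog : -Real.log p ≤ -Real.log P + Real.log Q := by
    have h1 : P ≤ Q * p := by
      have := ENNReal.toReal_mono (ENNReal.mul_ne_top (ENNReal.natCast_ne_top _)
        (measure_ne_top _ _)) hup
      rwa [ENNReal.toReal_mul, ENNReal.toReal_natCast] at this
    have h2 := Real.log_le_log hP0 h1
    rw [Real.log_mul hQ.ne' hp0.ne'] at h2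
    linarith
  have hlim : Tendsto (fun n : ℕ => 1 / (N : ℝ) ^ D * (1 / M + 1 / h n) * -Real.log p +
      (1 - (1 - (N : ℝ) / n) ^ D) * (1 + M / h n) * -Real.log (F (Set.Ici l')).toReal) atTop
      (𝓝 (1 / (N : ℝ) ^ D * (1 / M + 0) * -Real.log p +
        (1 - (1 - 0) ^ D) * (1 + 0) * -Real.log (F (Set.Ici l')).toReal)) := by
    have h1 : Tendsto (fun n => (h n : ℝ)) atTop atTop :=
      tendsto_natCast_atTop_atTop.comp hA.height
    have h2 : Tendsto (fun n => 1 / (h n : ℝ)) atTop (𝓝 0) := tendsto_const_nhds.div_atTop h1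
    have h3 : Tendsto (fun n => (M : ℝ) / (h n : ℝ)) atTop (𝓝 0) := tendsto_const_nhds.div_atTop h1
    have h4 : Tendsto (fun n : ℕ => (N : ℝ) / (n : ℝ)) atTop (𝓝 0) :=
      tendsto_const_nhds.div_atTop tendsto_natCast_atTop_atTop
    exact (((tendsto_const_nhds.add h2).const_mul _).mul_const _).add
      (((tendsto_const_nhds.sub ((tendsto_const_nhds.sub h4).pow D)).mul
        (tendsto_const_nhds.add h3)).mul_const _)
  have hlt : 1 / (N : ℝ) ^ D * (1 / M + 0) * -Real.log p +
        (1 - (1 - 0) ^ D) * (1 + 0) * -Real.log (F (Set.Ici l')).toReal <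
      -Real.log P / ((N : ℝ) ^ D * M) + Real.log Q / ((N : ℝ) ^ D * M) + ε := by
    have h1 : -Real.log p / ((N : ℝ) ^ D * M) ≤
        (-Real.log P + Real.log Q) / ((N : ℝ) ^ D * M) := by gcongr
    have h2 : 1 / (N : ℝ) ^ D * (1 / M + 0) * -Real.log p = -Real.log p / ((N : ℝ) ^ D * M) := by
      field_simp
      ring
    rw [add_div] at h1
    rw [h2, sub_zero, one_pow, sub_self, zero_mul, zero_mul, add_zero]
    linarith
  filter_upwards [hlim.eventually_lt_const hlt, eventually_ge_atTop N,
    hA.height.eventually_ge_atTop 1, hA.exponent.eventually_ge_atTop χ₀, hlev]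
    with n h1 h2 h3 h4 h5
  exact (rate_le_of_tiling F (discretize_mono h4) hN hM h2 h3 ha hal h5 hp hc).trans
    (EReal.coe_le_coe_iff.2 h1.le)

theorem limsup_rate_le_liminf_rate (D : ℕ) (F : Measure ℝ≥0) [IsProbabilityMeasure F] {l : ℝ≥0}
    (hl : (l : ℝ≥0∞) < supSupport F) {h h' : ℕ → ℕ} {χ χ' : ℕ → ℤ} (hA : Admissible h χ)
    (hA' : Admissible h' χ') :
    limsup (fun n => rate D F ((2 : ℝ≥0) ^ χ' n) n (h' n) l) atTop ≤
      liminf (fun n => rate D F ((2 : ℝ≥0) ^ χ n) n (h n) l) atTop := by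
  rw [← EReal.le_of_forall_lt_iff_le]
  intro y hy
  obtain ⟨z, hz, hzy⟩ := EReal.lt_iff_exists_real_btwn.1 hy
  have hzy' : z < y := EReal.coe_lt_coe_iff.1 hzy
  have hfreq := frequently_lt_of_liminf_lt (by isBoundedDefault) hz
  have hcard := (tendsto_log_card_div D l hA).eventually_lt_const
    (show (0 : ℝ) < (y - z) / 2 by linarith)
  obtain ⟨N, hNz, hcN, hN, hM⟩ := (hfreq.and_eventually (hcard.and ((eventually_ge_atTop 1).and
    (hA.height.eventually_ge_atTop 1)))).exists
  have hpos : upperProb D F ((2 : ℝ≥0) ^ χ N) N (h N) l ≠ 0 := by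
    intro h0
    rw [rate_eq_top_of_eq_zero F hN hM h0] at hNz
    exact not_top_lt hNz
  rw [rate_eq_of_ne_zero F hpos, EReal.coe_lt_coe_iff] at hNz
  refine limsup_le_of_le (by isBoundedDefault) ?_
  filter_upwards [eventually_rate_le F hl hA' hN hM hpos (show (0 : ℝ) < (y - z) / 2 by linarith)]
    with n hn
  exact hn.trans (EReal.coe_le_coe_iff.2 (by linarith))

/-! ### Levels above the supremum of the support -/

theorem card_topEdges_le (n m : ℕ) :
    ((boxEdges (fun _ : Fin D => n) m).filter
      fun e => e.2 = Fin.last D ∧ upperEnd e ∈ topFace (fun _ => n) m).card ≤ n ^ D := by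
  rw [← card_crossSection D n]
  refine Finset.card_le_card_of_injOn (fun e => base (upperEnd e)) ?_ ?_
  · intro e he
    exact (mem_slab.1 (Finset.mem_filter.1 he).2.2).1
  · intro e he e' he' hee
    obtain ⟨h1, h2⟩ := (Finset.mem_filter.1 he).2
    obtain ⟨h1', h2'⟩ := (Finset.mem_filter.1 he').2
    have h3 : upperEnd e = upperEnd e' := by
      rw [← snoc_base_height (upperEnd e), ← snoc_base_height (upperEnd e'),
        Finset.mem_singleton.1 (mem_slab.1 h2).2, Finset.mem_singleton.1 (mem_slab.1 h2').2]
      exact congrArg (fun x => (Fin.snoc (α := fun _ => ℤ) x (m : ℤ) : Vertex D)) hee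
    have h4 : e.2 = e'.2 := h1.trans h1'.symm
    refine Prod.ext ?_ h4
    simp only [upperEnd, h4] at h3
    exact add_right_cancel h3

theorem upperProb_eq_zero (F : Measure ℝ≥0) [IsProbabilityMeasure F] {l : ℝ≥0}
    (hl : supSupport F < l) {κ : ℝ≥0} {n : ℕ} (hn : 1 ≤ n) (m : ℕ) :
    upperProb D F κ n m l = 0 := by
  obtain ⟨r, hr, hrl⟩ := ENNReal.lt_iff_exists_nnreal_btwn.1 hl
  rw [ENNReal.coe_lt_coe] at hrl
  have hF : F (Set.Iio r) = 1 := by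
    by_contra h
    have hle : (r : ℝ≥0∞) ≤ supSupport F :=
      le_iSup₂_of_le (f := fun (l : ℝ≥0) (_ : F (Set.Iio l) < 1) => (l : ℝ≥0∞)) r
        (lt_of_le_of_ne prob_le_one h) le_rfl
    exact absurd hle (not_le.2 hr)
  have hae : ∀ᵐ t ∂(capacityLaw D F), ∀ e, t e < r := by
    rw [ae_all_iff]
    intro e
    have h1 : ∀ᵐ s ∂F, s < r := by
      rw [ae_iff]
      exact (prob_compl_eq_zero_iff measurableSet_Iio).2 hF
    exact (measurePreserving_eval_infinitePi (fun _ : Edge D => F) e).quasiMeasurePreserving.ae h1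
  refine measure_mono_null ?_ (ae_iff.1 hae)
  intro t ht hlt
  have hcap : ∀ e, (discretize κ t e : ℝ) ≤ r := by
    intro e
    have h1 : discretize κ t e ≤ t e := by
      rw [discretize]
      refine div_le_of_le_mul₀ zero_le zero_le ?_
      rw [mul_comm]
      exact Nat.floor_le zero_le
    exact_mod_cast h1.trans (hlt e).le
  have hmax : maxFlow (discretize κ t) (fun _ : Fin D => n) m ≤ r * (n : ℝ) ^ D := by
    refine csSup_le (nonempty_flow _ _ _) ?_
    rintro _ ⟨g, o, hgo, rfl⟩
    refine (flow_le_sum_capacity hgo).trans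
      ((Finset.sum_le_card_nsmul _ _ _ fun e _ => hcap e).trans ?_)
    rw [nsmul_eq_mul, mul_comm]
    gcongr
    exact_mod_cast card_topEdges_le n m
  have hn' : (0 : ℝ) < (n : ℝ) ^ D := by
    have : (0 : ℝ) < n := by exact_mod_cast hn
    positivity
  have hrl' : (r : ℝ) < l := by exact_mod_cast hrl
  have h2 := mul_lt_mul_of_pos_right hrl' hn'
  have h3 : (l : ℝ) * (n : ℝ) ^ D ≤ maxFlow (discretize κ t) (fun _ : Fin D => n) m := ht
  linarith

theorem tendsto_rate_top (D : ℕ) (F : Measure ℝ≥0) [IsProbabilityMeasure F] {l : ℝ≥0}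
    (hl : supSupport F < l) {h : ℕ → ℕ} {χ : ℕ → ℤ} (hA : Admissible h χ) :
    Tendsto (fun n => rate D F ((2 : ℝ≥0) ^ χ n) n (h n) l) atTop (𝓝 ⊤) := by
  refine tendsto_const_nhds.congr' ?_
  filter_upwards [eventually_ge_atTop 1, hA.height.eventually_ge_atTop 1] with n h1 h2
  exact (rate_eq_top_of_eq_zero F h1 h2 (upperProb_eq_zero F hl h1 (h n))).symm

/-- A concrete admissible pair, whose rates serve to define the limit. -/
theorem admissible_sq_id : Admissible (fun n => n ^ 2) (fun n => (n : ℤ)) where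
  height := tendsto_pow_atTop two_ne_zero
  mono := Nat.mono_cast
  exponent := tendsto_natCast_atTop_atTop
  ratio := by
    have h1 : Tendsto (fun n : ℕ => Real.log n / n) atTop (𝓝 0) :=
      Real.isLittleO_log_id_atTop.tendsto_div_nhds_zero.comp tendsto_natCast_atTop_atTop
    refine h1.congr' ?_
    filter_upwards [eventually_ge_atTop 1] with n hn
    have hn' : (n : ℝ) ≠ 0 := by positivity
    push_cast
    field_simp

end FPP

theorem theorem4 (D : ℕ) (hD : 1 ≤ D) (F : Measure ℝ≥0) [IsProbabilityMeasure F] :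
    ∃ ψ : ℝ≥0 → EReal,
      ∀ (h : ℕ → ℕ) (χ : ℕ → ℤ), FPP.Admissible h χ →
        ∀ l : ℝ≥0, (l : ℝ≥0∞) ≠ FPP.supSupport F →
          Tendsto (fun n : ℕ => FPP.rate D F ((2 : ℝ≥0) ^ χ n) n (h n) l) atTop (𝓝 (ψ l)) := by
  have hA₀ := FPP.admissible_sq_id
  refine ⟨fun l => limsup (fun n : ℕ => FPP.rate D F ((2 : ℝ≥0) ^ (n : ℤ)) n (n ^ 2) l) atTop,
    fun h χ hA l hl => ?_⟩
  rcases lt_or_gt_of_ne hl with hlt | hgt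
  · exact tendsto_of_le_liminf_of_limsup_le (FPP.limsup_rate_le_liminf_rate D F hlt hA hA₀)
      ((FPP.limsup_rate_le_liminf_rate D F hlt hA₀ hA).trans liminf_le_limsup)
  · have h₀ := (FPP.tendsto_rate_top D F hgt hA₀).limsup_eq
    beta_reduce
    rw [h₀]
    exact FPP.tendsto_rate_top D F hgt hA
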